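/- Setting. Let $K\ge 2$, $N\ge 2$ and let $\mathcal X$ be a finite alphabet with $|\mathcal X|\ge 2$; all entropies are taken to the base $|\mathcal X|$. $K$ independent messages $W_1,\dots,W_K$, each consisting of $L\ge 1$ i.i.d. uniform symbols of $\mathcal X$, are stored in each of $N$ databases. A scheme of message length $L$ consists of discrete random keys $F$ (of the user) and $S$ (shared by the databases), with $F$, $S$, $W_{1:K}$ independent; of queries $Q_n^{[k]}$ that are functions of $F$ ($1\le n\le N$, $1\le k\le K$); and of answers $A_n^{[k]}=\varphi_n(Q_n^{[k]},W_{1:K},S)\in\mathcal Y^{\ell_n}$ over a finite alphabet $\mathcal Y$, where the length $\ell_n$ depends only on $n$ and on the query. It is required that $H(W_k\mid A_{1:N}^{[k]},F)=0$ for all $k$ (recovery), that for each $n$ the distribution of $Q_n^{[k]}$ does not depend on $k$ (privacy), and that $$\tfrac1L\, I\big(W_{k'};Q_{1:N}^{[k]},A_{1:N}^{[k]},F\big)\le w\quad\text{for all }k'\ne k$$ (individual leakage constraint). The amount of common randomness is $\rho=H(S)/L$ and the download cost is $D=\log_{|\mathcal X|}|\mathcal Y|\cdot\sum_{n=1}^N\mathbb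 E(\ell_n)$. For given $w\ge 0$ and $\rho\ge 0$ let $D_{\min}/L$ denote the infimum of $D/L$ over all such schemes with common randomness $\rho$, of all message lengths $L\ge1$ and over all finite answer alphabets $\mathcal Y$ (it is $\infty$ if there is no such scheme). Theorem 2. Let $$\rho_{\min}^{\mathrm w}=\begin{cases}\frac1{N-1}-\frac{N}{N-1}\,w,&K=2,\\ 0,&K\ge 3.\end{cases}$$ If $\rho\ge\rho_{\min}^{\mathrm w}$, then $$D_{\min}=\begin{cases}L\left(\frac{N}{N-1}-\frac{1}{N-1}\,w\right),&0\le w\le \frac1{N^{K-1}},\\[2pt] L\left(1+\frac1N+\cdots+\frac1{N^{K-1}}\right),&w>\frac1{N^{K-1}},\end{cases}$$ and the infimum is attained by a scheme whenever $K\ge3$ (in particular for $\rho=0$, that is, without common randomness), or $\rho>\rho_{\min}^{\mathrm w}$, or $w$ is rational. If $\rho<\rho_{\min}^{\mathrm w}$, then no scheme exists, and $D_{\min}=\infty$. -/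

import Mathlib

open scoped ENNReal

noncomputable section

namespace PIR

/-! ### Entropy of discrete random variables

The random variables are functions on a discrete probability space `(Ω, μ)`, `μ : PMF Ω`.
Logarithms are taken to the base `b`; all quantities take values in `[0, ∞]`. -/

section Information

variable {Ω α β : Type*}

/-- Shannon entropy `H(U) = - ∑ᵤ P(U = u) log_b P(U = u)`, possibly infinite. -/
def entropy (b : ℕ) (μ : PMF Ω) (U : Ω → α) : ℝ≥0∞ :=
  (∑' u, ENNReal.ofReal (Real.negMulLog (μ.map U u).toReal)) / ENNReal.ofReal (Real.log b)

/-- Conditional entropy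
`H(U | V) = ∑ᵥ P(V = v) (- ∑ᵤ P(U = u | V = v) log_b P(U = u | V = v))`. -/
def condEntropy (b : ℕ) (μ : PMF Ω) (U : Ω → α) (V : Ω → β) : ℝ≥0∞ :=
  (∑' v, μ.map V v * ∑' u, ENNReal.ofReal
    (Real.negMulLog (μ.map (fun ω => (U ω, V ω)) (u, v) / μ.map V v).toReal)) /
      ENNReal.ofReal (Real.log b)

/-- Mutual information `I(U ; V) = H(U) - H(U | V)`. It is only used for variables `U` with
finitely many values, so that both terms are finite and `H(U | V) ≤ H(U)`. -/
def mutualInfo (b : ℕ) (μ : PMF Ω) (U : Ω → α) (V : Ω → β) : ℝ≥0∞ :=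
  entropy b μ U - condEntropy b μ U V

end Information

/-- The contents of the databases: `K` messages of `L` symbols of the alphabet `X` each. -/
abbrev Messages (X : Type*) (K L : ℕ) : Type _ := Fin K → Fin L → X

/-- The data of a retrieval scheme for `K` messages of `L` symbols over `X`, stored in each of
`N` databases:
the user's random key `F`, the common random key `S` of the databases, the queries `Qₙ^[k]` as
functions of `F`, and the answers as functions of the query, of the messages and of `S`. The
answer to the query `q` is a word over the finite alphabet `Y` whose length depends only on the
database and on `q`. -/
structure Scheme (X : Type*) (K N L : ℕ) where
  /-- alphabet of the user's random key `F` -/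
  Key : Type
  /-- distribution of `F` -/
  keyLaw : PMF Key
  /-- alphabet of the common random key `S` -/
  Common : Type
  /-- distribution of `S` -/
  commonLaw : PMF Common
  /-- the set of possible queries to each database -/
  Query : Fin N → Type
  /-- the query to database `n` when message `k` is desired and `F = f` -/
  query : Fin K → Key → (n : Fin N) → Query n
  /-- the answer alphabet -/
  Y : Type
  /-- the answer alphabet is finite -/
  fintypeY : Fintype Y
  /-- the length of the answer of database `n` to a query -/
  len : (n : Fin N) → Query n → ℕ
  /-- the answer of database `n` to a query -/
  answer : (n : Fin N) → Query n → Messages X K L → Common → List Y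
  /-- the answer to `q` consists of `len n q` symbols -/
  answer_length : ∀ n q W s, (answer n q W s).length = len n q

namespace Scheme

variable {X : Type*} {K N L : ℕ} (C : Scheme X K N L)

/-- The sample space: the values of `F`, of the messages `W` and of `S`. -/
abbrev Sample : Type _ := C.Key × Messages X K L × C.Common

/-- The joint law of `(F, W, S)`: the three are independent, and all the symbols of the messages
are independent and uniformly distributed over `X`. -/
def law [Fintype X] [Nonempty X] : PMF C.Sample :=
  C.keyLaw.bind fun f =>
    (PMF.uniformOfFintype (Messages X K L)).bind fun W =>
      C.commonLaw.map fun s => (f, W, s)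

/-- the random variable `F` -/
def key (ω : C.Sample) : C.Key := ω.1

/-- the random variable `W_k` -/
def message (k : Fin K) (ω : C.Sample) : Fin L → X := ω.2.1 k

/-- the random variable `S` -/
def common (ω : C.Sample) : C.Common := ω.2.2

/-- the random variable `Q_{1:N}^[k]` -/
def queries (k : Fin K) (ω : C.Sample) : (n : Fin N) → C.Query n := C.query k ω.1

/-- the random variable `A_{1:N}^[k]` -/
def answers (k : Fin K) (ω : C.Sample) : Fin N → List C.Y :=
  fun n => C.answer n (C.query k ω.1 n) ω.2.1 ω.2.2

/-- Recovery: the desired message is determined by the answers and by `F`, that is,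
`H(W_k | A_{1:N}^[k], F) = 0`. -/
def Recoverable [Fintype X] [Nonempty X] : Prop :=
  ∀ k, condEntropy (Fintype.card X) C.law (C.message k) (fun ω => (C.answers k ω, C.key ω)) = 0

/-- Privacy: the distribution of the query to any single database does not depend on the index
of the desired message. -/
def Private : Prop :=
  ∀ (n : Fin N) (k k' : Fin K),
    C.keyLaw.map (fun f => C.query k f n) = C.keyLaw.map (fun f => C.query k' f n)

/-- Normalized individual leakage `(1/L) I(W_{k'} ; Q_{1:N}^[k], A_{1:N}^[k], F)` about the
message `k'` when `k` is desired, logarithms to the base `|X|`. -/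
def leakage [Fintype X] [Nonempty X] (k k' : Fin K) : ℝ≥0∞ :=
  mutualInfo (Fintype.card X) C.law (C.message k')
    (fun ω => (C.queries k ω, C.answers k ω, C.key ω)) / L

/-- Normalized amount of common randomness `ρ = H(S) / L`, logarithms to the base `|X|`. -/
def commonRandomness [Fintype X] [Nonempty X] : ℝ≥0∞ :=
  entropy (Fintype.card X) C.law C.common / L

/-- Download cost `D = log_{|X|} |Y| * ∑ₙ E(ℓₙ)`, the expectation being over the random query to
database `n`. For a private scheme it does not depend on the index `k` of the desired message,
see `downloadCost_eq`. -/
def downloadCost [Fintype X] (k : Fin K) : ℝ≥0∞ :=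
  ENNReal.ofReal (Real.logb (Fintype.card X) (@Fintype.card C.Y C.fintypeY)) *
    ∑ n, ∑' q, C.keyLaw.map (fun f => C.query k f n) q * C.len n q

theorem downloadCost_eq [Fintype X] (h : C.Private) (k k' : Fin K) :
    C.downloadCost k = C.downloadCost k' := by
  unfold downloadCost
  congr 1
  refine Finset.sum_congr rfl fun n _ => ?_
  rw [h n k k']

/-- The scheme is a private information retrieval scheme with individual leakage at most `w` and
with the amount `ρ` of common randomness. -/
structure Admissible [Fintype X] [Nonempty X] (w ρ : ℝ) : Prop where
  recoverable : C.Recoverable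
  isPrivate : C.Private
  leakage_le : ∀ k k' : Fin K, k' ≠ k → C.leakage k k' ≤ ENNReal.ofReal w
  commonRandomness_eq : C.commonRandomness = ENNReal.ofReal ρ

end Scheme

section Tradeoff

variable (X : Type*) [Fintype X] [Nonempty X] (K N : ℕ) (w ρ : ℝ)

/-- The normalized download costs `D / L` of all the schemes, of all message lengths `L ≥ 1` and
over all answer alphabets, with individual leakage at most `w` and common randomness `ρ`. -/
def achievableCosts : Set ℝ≥0∞ :=
  {d | ∃ L : ℕ, 0 < L ∧ ∃ C : Scheme X K N L, C.Admissible w ρ ∧ ∀ k, d = C.downloadCost k / L}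

/-- The minimum download cost per message symbol, `D_min / L`; it is `∞` if there is no
scheme. -/
def minCost : ℝ≥0∞ := sInf (achievableCosts X K N w ρ)

end Tradeoff

/-- The threshold for the amount of common randomness (for `K ≥ 2`). -/
def rhoMin (K N : ℕ) (w : ℝ) : ℝ :=
  if K = 2 then 1 / ((N : ℝ) - 1) - N / ((N : ℝ) - 1) * w else 0

/-- The tradeoff curve:
`N/(N-1) - w/(N-1)` for `w ≤ 1/N^(K-1)`, and `1 + 1/N + ⋯ + 1/N^(K-1)` for larger `w`. -/
def tradeoff (K N : ℕ) (w : ℝ) : ℝ :=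
  if w ≤ 1 / (N : ℝ) ^ (K - 1) then N / ((N : ℝ) - 1) - 1 / ((N : ℝ) - 1) * w
  else ∑ i ∈ Finset.range K, 1 / (N : ℝ) ^ i

end PIR

end

/-!
# The tradeoff between download cost and individual leakage

**Lower bounds.** Write `C(k, I) = H(A_{1:N}^[k] | W_I, F)`. Recovery gives
`C(k, I) = H(W_k) + C(k, I ∪ {k})` for `k ∉ I` (`answersNats_insert`). Privacy gives
`C(k', I) ≤ N C(k, I)`: the entropies are averages over the keys, a single answer depends on the key
only through its query, the answers together have at most the sum of the entropies of the single
answers, and each single answer has at most the entropy of all (`answersNats_le_mul`). Alternating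
the two gives `1 + 1/N + ⋯ + 1/N^(K-1)` (`sum_le_answersNats`). The leakage constraint says
`C(k, ∅) ≤ C(k, {k'}) + w H(W_k')` (`answersNats_empty_le`); together with the other two, for a pair
of messages, it gives the linear part of the tradeoff (`exists_le_answersNats`). For `K = 2` the
leakage constraint also bounds `C(k, {k'}) - C(k, {k, k'})`, and `C(k, {k, k'}) ≤ H(S)`; this is the
bound on the common randomness (`rhoMin_le`).

**Schemes.** The user draws a uniform vector `v` with an entry in `ZMod N` for every message and
sends `v + n eₖ` to database `n`, so that every query is uniform. The database answers with the sum
of one block of each message, block number `0` being zero. The interference of the other messages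
is the same in all the answers, and it is known from the answer with block number `0` of `W_k`. For
`v = 0` nothing need be sent. Only vectors for which `W_k'` is the only undesired message with a nonzero
block leak, so that the leakage is `1/N^(K-1)`: this is the corner of the tradeoff. To remove the
leakage there are two ways, at the cost of downloading the answer to `v = 0` as well.
* For `K ≥ 3`, let block number `0` be a bijective linear image `M x` of block number `1`, with
  `M - 1` also bijective. Then every message contributes a uniform block, so that any third message
  hides `W_k'`, and the interference can still be eliminated.
* For `K = 2`, add a mask, a function of `S`, to all the answers.

A random mode of operation, known to the databases, interpolates between the schemes
(`Code.scheme_admissible`, `Code.scheme_downloadCost`). For `K = 2` the leakage is the average gap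
between the length of the block and the entropy of the mask, and what is saved in the download is
the average of the part of the block without a mask. The two agree for uniform masks of integral
length; with the least amount of common randomness and `w` irrational, a mask with the right
entropy is longer than this entropy by less than one symbol, which becomes negligible for long
blocks.
-/

noncomputable section

namespace PIR

/-! ### Entropy of random variables with finitely many values -/

section FiniteEntropy

variable {Ω α β γ : Type*}

/-- The probability `P(U = a)` as a real number. -/
def prob (μ : PMF Ω) (U : Ω → α) (a : α) : ℝ := (μ.map U a).toReal

/-- Shannon entropy, in nats, of a random variable with values in a finite type. Conditional
entropies are written as differences `H(U, V) - H(V)`. -/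
def finEntropy [Fintype α] (μ : PMF Ω) (U : Ω → α) : ℝ := ∑ a, Real.negMulLog (prob μ U a)

variable (μ : PMF Ω)

lemma prob_nonneg (U : Ω → α) (a : α) : 0 ≤ prob μ U a := ENNReal.toReal_nonneg

lemma prob_le_one (U : Ω → α) (a : α) : prob μ U a ≤ 1 :=
  ENNReal.toReal_le_of_le_ofReal zero_le_one (by
    rw [ENNReal.ofReal_one]; exact PMF.coe_le_one _ _)

lemma ofReal_prob (U : Ω → α) (a : α) : ENNReal.ofReal (prob μ U a) = μ.map U a :=
  ENNReal.ofReal_toReal (PMF.apply_ne_top _ _)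

lemma sum_prob [Fintype α] (U : Ω → α) : ∑ a, prob μ U a = 1 := by
  unfold prob
  rw [← ENNReal.toReal_sum fun a _ => PMF.apply_ne_top _ _, ← tsum_fintype (L := .unconditional _),
    PMF.tsum_coe, ENNReal.toReal_one]

lemma prob_comp [Fintype α] [DecidableEq β] (g : α → β) (U : Ω → α) (b : β) :
    prob μ (fun ω => g (U ω)) b = ∑ a, if g a = b then prob μ U a else 0 := by
  have h : μ.map (fun ω => g (U ω)) = (μ.map U).map g := by
    rw [PMF.map_comp]; rfl
  unfold prob
  rw [h, PMF.map_apply, tsum_fintype, ENNReal.toReal_sum]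
  · refine Finset.sum_congr rfl fun a _ => ?_
    by_cases hb : g a = b
    · simp [hb]
    · simp [hb, Ne.symm hb]
  · intro a _
    split_ifs
    · exact PMF.apply_ne_top _ _
    · simp

lemma prob_snd [Fintype α] [Fintype β] (U : Ω → α) (V : Ω → β) (b : β) :
    prob μ V b = ∑ a, prob μ (fun ω => (U ω, V ω)) (a, b) := by
  classical
  rw [show V = fun ω => Prod.snd (U ω, V ω) from rfl, prob_comp, Fintype.sum_prod_type]
  refine Finset.sum_congr rfl fun a _ => ?_
  rw [Finset.sum_eq_single b (fun x _ hx => by simp [hx]) (by simp)]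
  simp

lemma finEntropy_nonneg [Fintype α] (U : Ω → α) : 0 ≤ finEntropy μ U :=
  Finset.sum_nonneg fun a _ => Real.negMulLog_nonneg (prob_nonneg μ U a) (prob_le_one μ U a)

lemma negMulLog_sum_le {ι : Type*} (s : Finset ι) (p : ι → ℝ) (hp : ∀ i ∈ s, 0 ≤ p i) :
    Real.negMulLog (∑ i ∈ s, p i) ≤ ∑ i ∈ s, Real.negMulLog (p i) := by
  rw [Real.negMulLog, ← Finset.sum_neg_distrib, Finset.sum_mul]
  refine Finset.sum_le_sum fun i hi => ?_
  rcases (hp i hi).eq_or_lt with h | h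
  · simp [← h]
  · have : Real.log (p i) ≤ Real.log (∑ i ∈ s, p i) :=
      Real.log_le_log h (Finset.single_le_sum hp hi)
    rw [Real.negMulLog]
    nlinarith

/-- A function of `V` has at most the entropy of `V`. -/
lemma finEntropy_le_of_factors [Fintype α] [Fintype β] (U : Ω → α) (V : Ω → β)
    (h : ∀ ω ω', V ω = V ω' → U ω = U ω') : finEntropy μ U ≤ finEntropy μ V := by
  classical
  obtain ⟨ω₀, -⟩ := μ.support_nonempty
  have : Nonempty α := ⟨U ω₀⟩
  obtain ⟨g, rfl⟩ : ∃ g : β → α, U = fun ω => g (V ω) :=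
    (Function.factorsThrough_iff U).1 fun ω ω' hω => h ω ω' hω
  calc finEntropy μ (fun ω => g (V ω))
      = ∑ a, Real.negMulLog (∑ b with g b = a, prob μ V b) := by
        simp only [finEntropy, prob_comp, Finset.sum_filter]
    _ ≤ ∑ a, ∑ b with g b = a, Real.negMulLog (prob μ V b) :=
        Finset.sum_le_sum fun a _ => negMulLog_sum_le _ _ fun b _ => prob_nonneg _ _ _
    _ = finEntropy μ V := Finset.sum_fiberwise _ _ _

lemma finEntropy_congr [Fintype α] [Fintype β] (U : Ω → α) (V : Ω → β)
    (h : ∀ ω ω', V ω = V ω' ↔ U ω = U ω') : finEntropy μ U = finEntropy μ V :=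
  le_antisymm (finEntropy_le_of_factors μ U V fun ω ω' => (h ω ω').1)
    (finEntropy_le_of_factors μ V U fun ω ω' => (h ω ω').2)

lemma finEntropy_const [Fintype α] (a : α) : finEntropy μ (fun _ => a) = 0 := by
  classical
  refine Finset.sum_eq_zero fun b _ => ?_
  rw [show (fun _ : Ω => a) = Function.const Ω a from rfl, prob, PMF.map_const, PMF.pure_apply]
  split_ifs <;> simp

/-- Submodularity of entropy, `H(U, V, Z) + H(Z) ≤ H(U, Z) + H(V, Z)`. -/
lemma finEntropy_submodular [Fintype α] [Fintype β] [Fintype γ]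
    (U : Ω → α) (V : Ω → β) (Z : Ω → γ) :
    finEntropy μ (fun ω => (U ω, V ω, Z ω)) + finEntropy μ Z ≤
      finEntropy μ (fun ω => (U ω, Z ω)) + finEntropy μ (fun ω => (V ω, Z ω)) := by
  set p : α → β → γ → ℝ := fun u v z => prob μ (fun ω => (U ω, V ω, Z ω)) (u, v, z) with hp
  set pu : α → γ → ℝ := fun u z => prob μ (fun ω => (U ω, Z ω)) (u, z) with hpu
  set pv : β → γ → ℝ := fun v z => prob μ (fun ω => (V ω, Z ω)) (v, z) with hpv
  set pz : γ → ℝ := fun z => prob μ Z z with hpz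
  have p0 : ∀ u v z, 0 ≤ p u v z := fun _ _ _ => prob_nonneg _ _ _
  have eu : ∀ u z, pu u z = ∑ v, p u v z := by
    intro u z
    simp only [hpu, hp]
    rw [prob_snd μ V (fun ω => (U ω, Z ω))]
    refine Finset.sum_congr rfl fun v _ => ?_
    classical
    have := prob_comp μ (fun x : α × β × γ => (x.2.1, x.1, x.2.2)) (fun ω => (U ω, V ω, Z ω))
      (v, u, z)
    rw [this, Finset.sum_eq_single (u, v, z)]
    · simp
    · rintro ⟨a, b, c⟩ - h
      rw [if_neg]
      rintro h'
      simp only [Prod.mk.injEq] at h'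
      exact h (by simp [h'])
    · simp
  have ev : ∀ v z, pv v z = ∑ u, p u v z := fun v z => prob_snd μ U (fun ω => (V ω, Z ω)) (v, z)
  have ezu : ∀ z, pz z = ∑ u, pu u z := fun z => prob_snd μ U Z z
  have ezv : ∀ z, pz z = ∑ v, pv v z := fun z => prob_snd μ V Z z
  have pu0 : ∀ u z, 0 ≤ pu u z := fun _ _ => prob_nonneg _ _ _
  have pv0 : ∀ u z, 0 ≤ pv u z := fun _ _ => prob_nonneg _ _ _
  have pz0 : ∀ z, 0 ≤ pz z := fun _ => prob_nonneg _ _ _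
  -- the pointwise form of `log x ≤ x - 1`, where `x` is the ratio of the product law to `p`
  have key : ∀ u v z, p u v z * (Real.log (pu u z) + Real.log (pv v z) - Real.log (p u v z)
      - Real.log (pz z)) ≤ pu u z * pv v z / pz z - p u v z := by
    intro u v z
    rcases (p0 u v z).eq_or_lt with h | h
    · rw [← h]
      simpa using div_nonneg (mul_nonneg (pu0 u z) (pv0 v z)) (pz0 z)
    · have h1 : 0 < pu u z := h.trans_le (by
        rw [eu]; exact Finset.single_le_sum (f := fun v => p u v z) (fun v _ => p0 u v z)
          (Finset.mem_univ v))
      have h2 : 0 < pv v z := h.trans_le (by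
        rw [ev]; exact Finset.single_le_sum (f := fun u => p u v z) (fun u _ => p0 u v z)
          (Finset.mem_univ u))
      have h3 : 0 < pz z := h1.trans_le (by
        rw [ezu]; exact Finset.single_le_sum (f := fun u => pu u z) (fun u _ => pu0 u z)
          (Finset.mem_univ u))
      have h4 := Real.log_le_sub_one_of_pos (show 0 < pu u z * pv v z / pz z / p u v z by positivity)
      rw [Real.log_div (by positivity) h.ne', Real.log_div (by positivity) h3.ne',
        Real.log_mul h1.ne' h2.ne'] at h4
      have h5 := mul_le_mul_of_nonneg_left h4 h.le
      have h6 : p u v z * (pu u z * pv v z / pz z / p u v z - 1) =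
          pu u z * pv v z / pz z - p u v z := by field_simp
      rw [h6] at h5
      linarith
  have total : ∑ z, ∑ u, ∑ v, (pu u z * pv v z / pz z - p u v z) = 0 := by
    refine Finset.sum_eq_zero fun z _ => ?_
    simp_rw [Finset.sum_sub_distrib, ← eu, ← ezu, ← Finset.sum_div, ← Finset.mul_sum, ← ezv,
      ← Finset.sum_mul, ← ezu]
    rcases (pz0 z).eq_or_lt with h | h
    · simp [← h]
    · field_simp; ring
  have le : ∑ z, ∑ u, ∑ v, p u v z * (Real.log (pu u z) + Real.log (pv v z) - Real.log (p u v z)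
      - Real.log (pz z)) ≤ 0 :=
    total ▸ Finset.sum_le_sum fun z _ => Finset.sum_le_sum fun u _ => Finset.sum_le_sum
      fun v _ => key u v z
  have hU : finEntropy μ (fun ω => (U ω, Z ω)) = - ∑ z, ∑ u, ∑ v, p u v z * Real.log (pu u z) := by
    simp_rw [← Finset.sum_mul, ← eu]
    rw [finEntropy, Fintype.sum_prod_type_right, ← Finset.sum_neg_distrib]
    simp_rw [← Finset.sum_neg_distrib, ← neg_mul]
    rfl
  have hV : finEntropy μ (fun ω => (V ω, Z ω)) = - ∑ z, ∑ u, ∑ v, p u v z * Real.log (pv v z) := by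
    have : ∀ z, ∑ u, ∑ v, p u v z * Real.log (pv v z) = ∑ v, pv v z * Real.log (pv v z) := by
      intro z
      rw [Finset.sum_comm]
      simp_rw [← Finset.sum_mul, ← ev]
    simp_rw [this]
    rw [finEntropy, Fintype.sum_prod_type_right, ← Finset.sum_neg_distrib]
    simp_rw [← Finset.sum_neg_distrib, ← neg_mul]
    rfl
  have hZ : finEntropy μ Z = - ∑ z, ∑ u, ∑ v, p u v z * Real.log (pz z) := by
    simp_rw [← Finset.sum_mul, ← eu, ← ezu]
    rw [finEntropy, ← Finset.sum_neg_distrib]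
    simp_rw [← neg_mul]
    rfl
  have hUV : finEntropy μ (fun ω => (U ω, V ω, Z ω)) =
      - ∑ z, ∑ u, ∑ v, p u v z * Real.log (p u v z) := by
    rw [finEntropy, Fintype.sum_prod_type]
    simp_rw [Fintype.sum_prod_type_right]
    rw [Finset.sum_comm]
    simp_rw [← Finset.sum_neg_distrib, ← neg_mul]
    rfl
  rw [hU, hV, hZ, hUV]
  simp_rw [mul_sub, mul_add, Finset.sum_sub_distrib, Finset.sum_add_distrib] at le
  linarith

lemma finEntropy_prod_le [Fintype α] [Fintype β] (U : Ω → α) (V : Ω → β) :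
    finEntropy μ (fun ω => (U ω, V ω)) ≤ finEntropy μ U + finEntropy μ V := by
  have h := finEntropy_submodular μ U V (fun _ => ())
  rw [finEntropy_const, finEntropy_congr μ (fun ω => (U ω, V ω, ())) (fun ω => (U ω, V ω)) (by simp),
    finEntropy_congr μ (fun ω => (U ω, ())) U (by simp),
    finEntropy_congr μ (fun ω => (V ω, ())) V (by simp)] at h
  linarith

/-- Conditional subadditivity `H(A₁, …, A_N | Z) ≤ ∑ₙ H(Aₙ | Z)`. -/
lemma finEntropy_pi_le {N : ℕ} {δ : Fin N → Type*} [∀ n, Fintype (δ n)] [Fintype γ]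
    (A : Ω → (n : Fin N) → δ n) (Z : Ω → γ) :
    finEntropy μ (fun ω => (A ω, Z ω)) - finEntropy μ Z ≤
      ∑ n, (finEntropy μ (fun ω => (A ω n, Z ω)) - finEntropy μ Z) := by
  induction N with
  | zero =>
    rw [finEntropy_congr μ (fun ω => (A ω, Z ω)) Z fun ω ω' => by
      simp [Subsingleton.elim (A ω) (A ω')]]
    simp
  | succ N ih =>
    have h := ih (fun ω n => A ω n.succ)
    have h1 := finEntropy_submodular μ (fun ω => A ω 0) (fun ω (n : Fin N) => A ω n.succ) Z
    have h2 := finEntropy_le_of_factors μ (fun ω => (A ω, Z ω))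
      (fun ω => (A ω 0, (fun n : Fin N => A ω n.succ), Z ω)) (by
        intro ω ω' hω
        simp only [Prod.mk.injEq] at hω ⊢
        refine ⟨funext fun n => ?_, hω.2.2⟩
        refine Fin.cases hω.1 (fun i => congrFun hω.2.1 i) n)
    rw [Fin.sum_univ_succ]
    linarith

lemma finEntropy_le_log_card [Fintype α] (U : Ω → α) :
    finEntropy μ U ≤ Real.log (Fintype.card α) := by
  obtain ⟨ω₀, -⟩ := μ.support_nonempty
  have : Nonempty α := ⟨U ω₀⟩
  set n : ℝ := (Fintype.card α : ℝ) with hn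
  have n0 : 0 < n := by simp [hn, Fintype.card_pos]
  have key : ∀ a, Real.negMulLog (prob μ U a) - prob μ U a * Real.log n ≤ 1 / n - prob μ U a := by
    intro a
    rcases (prob_nonneg μ U a).eq_or_lt with h | h
    · simp [← h, n0.le]
    · have h1 := Real.log_le_sub_one_of_pos (show 0 < 1 / n / prob μ U a by positivity)
      rw [Real.log_div (by positivity) h.ne', Real.log_div one_ne_zero n0.ne', Real.log_one] at h1
      have h2 := mul_le_mul_of_nonneg_left h1 h.le
      have h3 : prob μ U a * (1 / n / prob μ U a - 1) = 1 / n - prob μ U a := by field_simp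
      rw [h3] at h2
      rw [Real.negMulLog]
      linarith
  have h := Finset.sum_le_sum fun a (_ : a ∈ Finset.univ) => key a
  rw [Finset.sum_sub_distrib, Finset.sum_sub_distrib, ← Finset.sum_mul, sum_prob] at h
  simp only [Finset.sum_const, Finset.card_univ, nsmul_eq_mul] at h
  rw [← hn, mul_one_div_cancel n0.ne'] at h
  rw [finEntropy]
  linarith

end FiniteEntropy

/-! ### Discrete entropies and conditioning on the user's key -/

section Discrete

variable {Ω Φ α β γ : Type*}

/-- Conditional entropy `H(U | V)` in nats, of discrete random variables. -/
def condNats (μ : PMF Ω) (U : Ω → α) (V : Ω → β) : ℝ≥0∞ :=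
  ∑' v, μ.map V v * ∑' u, ENNReal.ofReal
    (Real.negMulLog (μ.map (fun ω => (U ω, V ω)) (u, v) / μ.map V v).toReal)

lemma condEntropy_eq (b : ℕ) (μ : PMF Ω) (U : Ω → α) (V : Ω → β) :
    condEntropy b μ U V = condNats μ U V / ENNReal.ofReal (Real.log b) := rfl

lemma entropy_eq [Fintype α] (b : ℕ) (μ : PMF Ω) (U : Ω → α) :
    entropy b μ U = ENNReal.ofReal (finEntropy μ U) / ENNReal.ofReal (Real.log b) := by
  rw [entropy, tsum_fintype, finEntropy, ENNReal.ofReal_sum_of_nonneg]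
  · rfl
  · exact fun a _ => Real.negMulLog_nonneg (prob_nonneg μ U a) (prob_le_one μ U a)

lemma tsum_map_mul (p : PMF α) (φ : α → β) (g : β → ℝ≥0∞) :
    ∑' b, p.map φ b * g b = ∑' a, p a * g (φ a) := by
  classical
  simp_rw [PMF.map_apply, ← ENNReal.tsum_mul_right]
  rw [ENNReal.tsum_comm]
  refine tsum_congr fun a => ?_
  rw [tsum_eq_single (φ a) (fun b hb => by simp [hb])]
  simp

lemma map_injective_apply (p : PMF α) {e : α → β} (he : e.Injective) (a : α) :
    p.map e (e a) = p a := by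
  classical
  rw [PMF.map_apply, tsum_eq_single a (fun b hb => by rw [if_neg fun h => hb (he h).symm])]
  simp

lemma map_apply_eq_zero (p : PMF α) {φ : α → β} {b : β} (h : ∀ a, φ a ≠ b) :
    p.map φ b = 0 := by
  classical
  rw [PMF.map_apply]
  simp [fun a => (h a).symm]

lemma map_bind_fiber_apply (p : PMF Φ) (ν : PMF Ω) (V : Φ × Ω → β) (κ : β → Φ)
    (hκ : ∀ f ω, κ (V (f, ω)) = f) (v : β) :
    (p.bind fun f => ν.map fun ω => (f, ω)).map V v =
      p (κ v) * ν.map (fun ω => V (κ v, ω)) v := by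
  rw [PMF.map_bind, PMF.bind_apply, tsum_eq_single (κ v)]
  · rw [PMF.map_comp]; rfl
  · intro f hf
    rw [PMF.map_comp, map_apply_eq_zero, mul_zero]
    rintro ω rfl
    exact hf (hκ f ω).symm

/-- If `V` determines the independent component `f`, then `H(U | V)` is the average over `f` of
the conditional entropies for fixed `f`. -/
lemma condNats_fiber (p : PMF Φ) (ν : PMF Ω) (U : Φ × Ω → α) (V : Φ × Ω → β) (κ : β → Φ)
    (hκ : ∀ f ω, κ (V (f, ω)) = f) :
    condNats (p.bind fun f => ν.map fun ω => (f, ω)) U V =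
      ∑' f, p f * condNats ν (fun ω => U (f, ω)) (fun ω => V (f, ω)) := by
  set μ := p.bind fun f => ν.map fun ω => (f, ω) with hμ
  unfold condNats
  have swap : ∀ G : Φ → β → ℝ≥0∞, ∑' f, p f * ∑' v, G f v = ∑' v, ∑' f, p f * G f v := fun G => by
    simp_rw [← ENNReal.tsum_mul_left]
    exact ENNReal.tsum_comm
  rw [swap]
  refine tsum_congr fun v => ?_
  rw [tsum_eq_single (α := ℝ≥0∞) (κ v), ← mul_assoc, map_bind_fiber_apply p ν V κ hκ]
  · rcases eq_or_ne (p (κ v)) 0 with h0 | h0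
    · simp [h0]
    congr 1
    refine tsum_congr fun u => ?_
    have := map_bind_fiber_apply p ν (fun x => (U x, V x)) (fun y => κ y.2) (fun f ω => hκ f ω) (u, v)
    rw [this, ENNReal.mul_div_mul_left _ _ h0 (PMF.apply_ne_top _ _)]
  · intro f hf
    rw [map_apply_eq_zero ν (b := v) (φ := fun ω => V (f, ω))]
    · simp
    · rintro ω rfl
      exact hf (hκ f ω).symm

lemma condNats_comp_injective (μ : PMF Ω) (U : Ω → α) (V : Ω → β) {e : β → γ}
    (he : e.Injective) : condNats μ U (fun ω => e (V ω)) = condNats μ U V := by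
  have h1 : ∀ v, μ.map (fun ω => e (V ω)) (e v) = μ.map V v := fun v => by
    rw [show μ.map (fun ω => e (V ω)) = (μ.map V).map e by rw [PMF.map_comp]; rfl,
      map_injective_apply _ he]
  have h2 : ∀ u v, μ.map (fun ω => (U ω, e (V ω))) (u, e v) = μ.map (fun ω => (U ω, V ω)) (u, v) :=
    fun u v => by
      have he' : (Prod.map id e : α × β → α × γ).Injective := Function.injective_id.prodMap he
      rw [show μ.map (fun ω => (U ω, e (V ω))) = (μ.map fun ω => (U ω, V ω)).map (Prod.map id e) by
        rw [PMF.map_comp]; rfl]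
      exact map_injective_apply _ he' (u, v)
  unfold condNats
  rw [← he.tsum_eq]
  · refine tsum_congr fun v => ?_
    simp_rw [h1, h2]
  · intro w hw
    by_contra hr
    refine hw ?_
    simp only
    rw [map_apply_eq_zero, zero_mul]
    exact fun ω h => hr ⟨V ω, h⟩

lemma condNats_eq_ofReal [Fintype α] [Fintype β] (μ : PMF Ω) (U : Ω → α) (V : Ω → β) :
    condNats μ U V =
      ENNReal.ofReal (finEntropy μ (fun ω => (U ω, V ω)) - finEntropy μ V) := by
  have hle : ∀ u v, prob μ (fun ω => (U ω, V ω)) (u, v) ≤ prob μ V v := by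
    intro u v
    rw [prob_snd μ U V v]
    exact Finset.single_le_sum (f := fun u => prob μ (fun ω => (U ω, V ω)) (u, v))
      (fun u _ => prob_nonneg _ _ _) (Finset.mem_univ u)
  have hnn : ∀ u v, 0 ≤ Real.negMulLog (prob μ (fun ω => (U ω, V ω)) (u, v) / prob μ V v) :=
    fun u v => Real.negMulLog_nonneg (div_nonneg (prob_nonneg _ _ _) (prob_nonneg _ _ _))
      (div_le_one_of_le₀ (hle u v) (prob_nonneg _ _ _))
  have hv : ∀ v, μ.map V v * ∑' u, ENNReal.ofReal
      (Real.negMulLog (μ.map (fun ω => (U ω, V ω)) (u, v) / μ.map V v).toReal) =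
      ENNReal.ofReal (prob μ V v *
        ∑ u, Real.negMulLog (prob μ (fun ω => (U ω, V ω)) (u, v) / prob μ V v)) := by
    intro v
    rw [ENNReal.ofReal_mul (prob_nonneg _ _ _), ofReal_prob, tsum_fintype,
      ENNReal.ofReal_sum_of_nonneg fun u _ => hnn u v]
    simp_rw [ENNReal.toReal_div]
    rfl
  unfold condNats
  simp_rw [hv]
  rw [tsum_fintype, ← ENNReal.ofReal_sum_of_nonneg fun v _ =>
    mul_nonneg (prob_nonneg _ _ _) (Finset.sum_nonneg fun u _ => hnn u v)]
  congr 1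
  rw [finEntropy, Fintype.sum_prod_type_right, finEntropy, ← Finset.sum_sub_distrib]
  refine Finset.sum_congr rfl fun v _ => ?_
  rcases (prob_nonneg μ V v).eq_or_lt with h | h
  · have : ∀ u, prob μ (fun ω => (U ω, V ω)) (u, v) = 0 := fun u =>
      le_antisymm ((hle u v).trans h.symm.le) (prob_nonneg _ _ _)
    simp [← h, this]
  · have e : ∀ u, prob μ V v * Real.negMulLog (prob μ (fun ω => (U ω, V ω)) (u, v) / prob μ V v) =
        Real.negMulLog (prob μ (fun ω => (U ω, V ω)) (u, v)) +
          prob μ (fun ω => (U ω, V ω)) (u, v) * Real.log (prob μ V v) := by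
      intro u
      rcases (prob_nonneg μ (fun ω => (U ω, V ω)) (u, v)).eq_or_lt with h' | h'
      · simp [← h']
      · rw [Real.negMulLog, Real.negMulLog, Real.log_div h'.ne' h.ne']
        field_simp
        ring
    rw [Finset.mul_sum]
    simp_rw [e]
    rw [Finset.sum_add_distrib, ← Finset.sum_mul, ← prob_snd, Real.negMulLog]
    ring

/-- A function with finitely many values has at most the entropy of its argument, which may have
infinitely many values. -/
lemma ofReal_finEntropy_le_tsum [Fintype α] (p : PMF β) (g : β → α) :
    ENNReal.ofReal (finEntropy p g) ≤ ∑' s, ENNReal.ofReal (Real.negMulLog (p s).toReal) := by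
  classical
  have hs : ∀ a s, g s = a → p s ≤ p.map g a := by
    rintro a s rfl
    rw [PMF.map_apply]
    exact (le_of_eq (by simp)).trans (ENNReal.le_tsum s)
  calc ENNReal.ofReal (finEntropy p g)
      = ∑' a, p.map g a * ENNReal.ofReal (-Real.log (prob p g a)) := by
        rw [finEntropy, ENNReal.ofReal_sum_of_nonneg fun a _ =>
          Real.negMulLog_nonneg (prob_nonneg _ _ _) (prob_le_one _ _ _), tsum_fintype]
        refine Finset.sum_congr rfl fun a _ => ?_
        rw [← ofReal_prob, ← ENNReal.ofReal_mul (prob_nonneg _ _ _), Real.negMulLog]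
        congr 1; ring
    _ = ∑' s, p s * ENNReal.ofReal (-Real.log (prob p g (g s))) := tsum_map_mul _ _ _
    _ ≤ ∑' s, ENNReal.ofReal (Real.negMulLog (p s).toReal) := by
        refine ENNReal.tsum_le_tsum fun s => ?_
        rcases eq_or_ne (p s) 0 with h | h
        · simp [h]
        have h0 : 0 < (p s).toReal := ENNReal.toReal_pos h (PMF.apply_ne_top _ _)
        have h1 : (p s).toReal ≤ prob p g (g s) :=
          ENNReal.toReal_mono (PMF.apply_ne_top _ _) (hs _ _ rfl)
        have h2 := Real.log_le_log h0 h1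
        rw [Real.negMulLog, neg_mul, ← mul_neg, ENNReal.ofReal_mul h0.le,
          ENNReal.ofReal_toReal (PMF.apply_ne_top _ _)]
        gcongr

end Discrete

/-! ### The random variables of a scheme for a fixed key of the user -/

section Database

variable {M σ α β : Type*} [Fintype M] [Nonempty M]

/-- The joint law of a uniform variable and an independent variable with law `p`. -/
def dbLaw (M : Type*) [Fintype M] [Nonempty M] (p : PMF σ) : PMF (M × σ) :=
  (PMF.uniformOfFintype M).bind fun W => p.map fun s => (W, s)

lemma dbLaw_map_snd (p : PMF σ) : (dbLaw M p).map Prod.snd = p := by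
  rw [dbLaw, PMF.map_bind]
  simp_rw [PMF.map_comp]
  simp only [Function.comp_def, PMF.bind_const]
  exact PMF.map_id p

lemma prob_dbLaw (p : PMF σ) (g : M × σ → α) (a : α) (w : M) :
    prob (dbLaw M p) (fun ω => (g ω, ω.1)) (a, w) =
      1 / Fintype.card M * prob p (fun s => g (w, s)) a := by
  have h := map_bind_fiber_apply (PMF.uniformOfFintype M) p (fun ω => (g ω, ω.1)) Prod.snd
    (fun _ _ => rfl) (a, w)
  have h2 := map_injective_apply (p.map fun s => g (w, s)) (e := fun a => (a, w))
    (fun a b hab => (Prod.mk.inj hab).1) a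
  rw [PMF.map_comp] at h2
  simp only [Function.comp_def] at h2
  unfold prob dbLaw
  rw [h, h2, ENNReal.toReal_mul]
  simp

/-- `H(g(W, S), W) = H(W) + H(g(W, S) | W)` for `W` uniform and independent of `S`. -/
lemma finEntropy_dbLaw [Fintype α] (p : PMF σ) (g : M × σ → α) :
    finEntropy (dbLaw M p) (fun ω => (g ω, ω.1)) = Real.log (Fintype.card M) +
      1 / Fintype.card M * ∑ w, finEntropy p (fun s => g (w, s)) := by
  have h0 : (Fintype.card M : ℝ) ≠ 0 := by simp
  rw [finEntropy, Fintype.sum_prod_type_right]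
  simp_rw [prob_dbLaw, Real.negMulLog_mul, Finset.sum_add_distrib, ← Finset.mul_sum,
    ← Finset.sum_mul, sum_prob]
  simp only [Real.negMulLog, one_div, Real.log_inv, Finset.sum_const, Finset.card_univ,
    nsmul_eq_mul, finEntropy]
  field_simp

lemma finEntropy_dbLaw_snd [Fintype α] (p : PMF σ) (g : σ → α) :
    finEntropy (dbLaw M p) (fun ω => (g ω.2, ω.1)) =
      Real.log (Fintype.card M) + finEntropy p g := by
  rw [finEntropy_dbLaw p (fun ω => g ω.2)]
  simp

lemma finEntropy_dbLaw_fst (p : PMF σ) :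
    finEntropy (dbLaw M p) (fun ω => ω.1) = Real.log (Fintype.card M) := by
  have := finEntropy_dbLaw_snd (M := M) p (fun _ => ())
  rw [finEntropy_const, add_zero] at this
  rw [← this]
  exact finEntropy_congr _ _ _ (by simp)

/-- `H(g(W, S), W) ≤ H(W) + H(S)`. -/
lemma ofReal_finEntropy_dbLaw_le [Fintype α] (p : PMF σ) (g : M × σ → α) :
    ENNReal.ofReal (finEntropy (dbLaw M p) (fun ω => (g ω, ω.1)) - Real.log (Fintype.card M)) ≤
      ∑' s, ENNReal.ofReal (Real.negMulLog (p s).toReal) := by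
  rw [finEntropy_dbLaw, add_sub_cancel_left]
  set B := ∑' s, ENNReal.ofReal (Real.negMulLog (p s).toReal) with hB
  rcases eq_or_ne B ⊤ with h | h
  · simp [h]
  rw [ENNReal.ofReal_le_iff_le_toReal h]
  have h1 : ∀ w, finEntropy p (fun s => g (w, s)) ≤ B.toReal := fun w =>
    (ENNReal.ofReal_le_iff_le_toReal h).1 (ofReal_finEntropy_le_tsum p _)
  have h0 : (0 : ℝ) < Fintype.card M := by simp [Fintype.card_pos]
  have h2 := Finset.sum_le_sum fun w (_ : w ∈ Finset.univ) => h1 w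
  simp only [Finset.sum_const, Finset.card_univ, nsmul_eq_mul] at h2
  rw [one_div, inv_mul_le_iff₀ h0]
  exact h2

end Database

namespace Scheme

variable {X : Type*} {K N L : ℕ} (C : Scheme X K N L)

instance : Fintype C.Y := C.fintypeY

/-- The answer of database `n` to the query `q`, as a word whose length is part of its type. -/
def answerVec (n : Fin N) (q : C.Query n) (ω : Messages X K L × C.Common) :
    List.Vector C.Y (C.len n q) :=
  ⟨C.answer n q ω.1 ω.2, C.answer_length n q ω.1 ω.2⟩

/-- The answers of all the databases when `k` is desired and the user's key is `f`. -/
def answersVec (k : Fin K) (f : C.Key) (ω : Messages X K L × C.Common) (n : Fin N) :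
    List.Vector C.Y (C.len n (C.query k f n)) :=
  C.answerVec n (C.query k f n) ω

lemma answersVec_coe_injective (k : Fin K) (f : C.Key) : Function.Injective
    (fun (a : (n : Fin N) → List.Vector C.Y (C.len n (C.query k f n))) (n : Fin N) =>
      (a n).toList) := by
  intro a a' h
  funext n
  exact List.Vector.toList_injective (congrFun h n)

variable [Fintype X] [Nonempty X]

/-- The joint law of `(W, S)`. -/
abbrev dataLaw : PMF (Messages X K L × C.Common) := dbLaw (Messages X K L) C.commonLaw

lemma law_eq : C.law = C.keyLaw.bind fun f => C.dataLaw.map fun ω => (f, ω) := by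
  unfold law dataLaw dbLaw
  simp_rw [PMF.map_bind, PMF.map_comp]
  rfl

lemma law_map_snd : C.law.map Prod.snd = C.dataLaw := by
  rw [law_eq, PMF.map_bind]
  simp_rw [PMF.map_comp]
  simp only [Function.comp_def, PMF.bind_const]
  exact PMF.map_id _

/-- `H(W_k' | A_{1:N}^[k], F)` as an average over the keys. -/
lemma condEntropy_answers_key (b : ℕ) (k k' : Fin K) :
    condEntropy b C.law (C.message k') (fun ω => (C.answers k ω, C.key ω)) =
      (∑' f, C.keyLaw f * ENNReal.ofReal
        (finEntropy C.dataLaw (fun ω => (ω.1 k', C.answersVec k f ω)) -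
          finEntropy C.dataLaw (C.answersVec k f))) / ENNReal.ofReal (Real.log b) := by
  rw [condEntropy_eq, law_eq, condNats_fiber _ _ _ _ (fun v => v.2) (fun _ _ => rfl)]
  congr 1
  refine tsum_congr fun f => ?_
  rw [← condNats_eq_ofReal]
  congr 1
  exact condNats_comp_injective C.dataLaw (fun ω => ω.1 k') (C.answersVec k f)
    (e := fun a => ((fun n => (a n).toList), f))
    (fun a a' h => C.answersVec_coe_injective k f (Prod.mk.inj h).1)

/-- `H(W_k' | Q_{1:N}^[k], A_{1:N}^[k], F)` as an average over the keys. -/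
lemma condEntropy_queries_answers_key (b : ℕ) (k k' : Fin K) :
    condEntropy b C.law (C.message k') (fun ω => (C.queries k ω, C.answers k ω, C.key ω)) =
      (∑' f, C.keyLaw f * ENNReal.ofReal
        (finEntropy C.dataLaw (fun ω => (ω.1 k', C.answersVec k f ω)) -
          finEntropy C.dataLaw (C.answersVec k f))) / ENNReal.ofReal (Real.log b) := by
  rw [condEntropy_eq, law_eq, condNats_fiber _ _ _ _ (fun v => v.2.2) (fun _ _ => rfl)]
  congr 1
  refine tsum_congr fun f => ?_
  rw [← condNats_eq_ofReal]
  congr 1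
  exact condNats_comp_injective C.dataLaw (fun ω => ω.1 k') (C.answersVec k f)
    (e := fun a => (C.query k f, (fun n => (a n).toList), f))
    (fun a a' h => C.answersVec_coe_injective k f (Prod.mk.inj (Prod.mk.inj h).2).1)

end Scheme

/-! ### Lower bounds on the download cost and on the common randomness -/

namespace Scheme

variable {X : Type*} {K N L : ℕ} (C : Scheme X K N L)

/-- The messages with index in `I`. -/
def messagesIn {σ : Type*} (I : Finset (Fin K)) (ω : Messages X K L × σ) : I → Fin L → X :=
  fun i => ω.1 i

variable [Fintype X] [Nonempty X]

/-- The entropy of one message in nats. -/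
def messageNats (X : Type*) [Fintype X] (L : ℕ) : ℝ := L * Real.log (Fintype.card X)

omit [Nonempty X] in
lemma messageNats_nonneg : 0 ≤ messageNats X L :=
  mul_nonneg (Nat.cast_nonneg _) (Real.log_natCast_nonneg _)

omit [Nonempty X] in
lemma log_card_messages :
    Real.log (Fintype.card (Messages X K L)) = K * messageNats X L := by
  simp [messageNats, Real.log_pow]

omit [Nonempty X] in
lemma finEntropy_messagesIn_le {σ : Type*} (μ : PMF (Messages X K L × σ)) (I : Finset (Fin K)) :
    finEntropy μ (messagesIn I) ≤ I.card * messageNats X L := by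
  refine (finEntropy_le_log_card _ _).trans_eq ?_
  simp [messageNats, Real.log_pow]

lemma finEntropy_messagesIn (I : Finset (Fin K)) :
    finEntropy C.dataLaw (messagesIn I) = I.card * messageNats X L := by
  refine le_antisymm (finEntropy_messagesIn_le _ I) ?_
  have h1 : finEntropy C.dataLaw (fun ω => ω.1) = K * messageNats X L := by
    rw [finEntropy_dbLaw_fst, log_card_messages]
  have h2 := finEntropy_le_of_factors C.dataLaw (fun ω => ω.1)
    (fun ω => (messagesIn I ω, messagesIn Iᶜ ω)) (by
      intro ω ω' h
      simp only [Prod.mk.injEq] at h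
      funext i
      by_cases hi : i ∈ I
      · exact congrFun h.1 ⟨i, hi⟩
      · exact congrFun h.2 ⟨i, Finset.mem_compl.2 hi⟩)
  have h3 := finEntropy_prod_le C.dataLaw (messagesIn I) (messagesIn Iᶜ)
  have h4 := finEntropy_messagesIn_le C.dataLaw Iᶜ
  have h5 : (I.card : ℝ) + Iᶜ.card = K := by
    exact_mod_cast (Finset.card_add_card_compl I).trans (Fintype.card_fin K)
  rw [h1, ← h5, add_mul] at h2
  linarith

lemma finEntropy_message (k : Fin K) :
    finEntropy C.dataLaw (fun ω => ω.1 k) = messageNats X L := by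
  have := C.finEntropy_messagesIn {k}
  rw [Finset.card_singleton, Nat.cast_one, one_mul] at this
  rw [← this]
  refine finEntropy_congr _ _ _ fun ω ω' => ⟨fun h => congrFun h ⟨k, by simp⟩, fun h => ?_⟩
  funext ⟨i, hi⟩
  rw [Finset.mem_singleton] at hi
  subst hi
  exact h

/-- `H(A_{1:N}^[k], W_I)` in nats, for the key `f` of the user. -/
def jointNats (k : Fin K) (I : Finset (Fin K)) (f : C.Key) : ℝ :=
  finEntropy C.dataLaw (fun ω => (C.answersVec k f ω, messagesIn I ω))

/-- `H(A_n, W_I)` in nats, where `A_n` is the answer to the query `q`. -/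
def answerNats (I : Finset (Fin K)) (n : Fin N) (q : C.Query n) : ℝ :=
  finEntropy C.dataLaw (fun ω => (C.answerVec n q ω, messagesIn I ω))

lemma jointNats_nonneg (k : Fin K) (I : Finset (Fin K)) (f : C.Key) : 0 ≤ C.jointNats k I f :=
  finEntropy_nonneg _ _

lemma answerNats_nonneg (I : Finset (Fin K)) (n : Fin N) (q : C.Query n) :
    0 ≤ C.answerNats I n q := finEntropy_nonneg _ _

lemma answerNats_le (k : Fin K) (I : Finset (Fin K)) (f : C.Key) (n : Fin N) :
    C.answerNats I n (C.query k f n) ≤ C.jointNats k I f := by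
  refine finEntropy_le_of_factors _ _ _ fun ω ω' h => ?_
  simp only [Prod.mk.injEq] at h ⊢
  exact ⟨congrFun h.1 n, h.2⟩

lemma jointNats_sub_le (k : Fin K) (I : Finset (Fin K)) (f : C.Key) :
    C.jointNats k I f - I.card * messageNats X L ≤
      ∑ n, (C.answerNats I n (C.query k f n) - I.card * messageNats X L) := by
  rw [← C.finEntropy_messagesIn I]
  exact finEntropy_pi_le C.dataLaw (C.answersVec k f) (messagesIn I)

lemma le_jointNats (k : Fin K) (I : Finset (Fin K)) (f : C.Key) :
    I.card * messageNats X L ≤ C.jointNats k I f := by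
  rw [← C.finEntropy_messagesIn I]
  exact finEntropy_le_of_factors _ _ _ fun ω ω' h => (Prod.mk.inj h).2

lemma jointNats_mono (k : Fin K) {I J : Finset (Fin K)} (h : I ⊆ J) (f : C.Key) :
    C.jointNats k I f ≤ C.jointNats k J f := by
  refine finEntropy_le_of_factors _ _ _ fun ω ω' hω => ?_
  simp only [Prod.mk.injEq] at hω ⊢
  exact ⟨hω.1, funext fun i => congrFun hω.2 ⟨i, h i.2⟩⟩

lemma jointNats_empty (k : Fin K) (f : C.Key) :
    C.jointNats k ∅ f = finEntropy C.dataLaw (C.answersVec k f) :=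
  finEntropy_congr _ _ _ fun ω ω' => by
    simp [Subsingleton.elim (messagesIn (∅ : Finset (Fin K)) ω) (messagesIn ∅ ω')]

lemma jointNats_singleton (k k' : Fin K) (f : C.Key) :
    C.jointNats k {k'} f = finEntropy C.dataLaw (fun ω => (ω.1 k', C.answersVec k f ω)) := by
  refine finEntropy_congr _ _ _ fun ω ω' => ?_
  simp only [Prod.mk.injEq]
  refine ⟨fun h => ⟨h.2, funext fun ⟨i, hi⟩ => ?_⟩, fun h => ⟨congrFun h.2 ⟨k', by simp⟩, h.1⟩⟩
  rw [Finset.mem_singleton] at hi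
  subst hi
  exact h.1

/-- If the answers determine `W_k`, then joining `W_k` does not increase the entropy. -/
lemma jointNats_insert {k : Fin K} {f : C.Key}
    (h : finEntropy C.dataLaw (fun ω => (ω.1 k, C.answersVec k f ω)) ≤
      finEntropy C.dataLaw (C.answersVec k f)) (I : Finset (Fin K)) :
    C.jointNats k (insert k I) f = C.jointNats k I f := by
  refine le_antisymm ?_ (C.jointNats_mono k (Finset.subset_insert k I) f)
  have h1 := finEntropy_submodular C.dataLaw (fun ω => ω.1 k) (messagesIn I) (C.answersVec k f)
  have h2 : C.jointNats k (insert k I) f ≤ finEntropy C.dataLaw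
      (fun ω => (ω.1 k, messagesIn I ω, C.answersVec k f ω)) := by
    refine finEntropy_le_of_factors _ _ _ fun ω ω' h => ?_
    simp only [Prod.mk.injEq] at h ⊢
    refine ⟨h.2.2, funext fun ⟨i, hi⟩ => ?_⟩
    rcases Finset.mem_insert.1 hi with rfl | hi'
    · exact h.1
    · exact congrFun h.2.1 ⟨i, hi'⟩
  have h3 : C.jointNats k I f = finEntropy C.dataLaw
      (fun ω => (messagesIn I ω, C.answersVec k f ω)) :=
    finEntropy_congr _ _ _ fun ω ω' => by simp [and_comm]
  linarith

/-- The average over the user's key of `g ≥ 0`. -/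
def keyAvg (g : C.Key → ℝ) : ℝ≥0∞ := ∑' f, C.keyLaw f * ENNReal.ofReal (g f)

omit [Fintype X] [Nonempty X] in
lemma keyAvg_mono {g g' : C.Key → ℝ} (h : ∀ f, g f ≤ g' f) : C.keyAvg g ≤ C.keyAvg g' :=
  ENNReal.tsum_le_tsum fun f => by gcongr; exact h f

omit [Fintype X] [Nonempty X] in
lemma keyAvg_const (c : ℝ) : C.keyAvg (fun _ => c) = ENNReal.ofReal c := by
  rw [keyAvg, ENNReal.tsum_mul_right, PMF.tsum_coe, one_mul]

omit [Fintype X] [Nonempty X] in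
lemma keyAvg_add {g g' : C.Key → ℝ} (h : ∀ f, 0 ≤ g f) (h' : ∀ f, 0 ≤ g' f) :
    C.keyAvg (fun f => g f + g' f) = C.keyAvg g + C.keyAvg g' := by
  rw [keyAvg, keyAvg, keyAvg, ← ENNReal.tsum_add]
  refine tsum_congr fun f => ?_
  rw [ENNReal.ofReal_add (h f) (h' f), mul_add]

omit [Fintype X] [Nonempty X] in
lemma keyAvg_sum {ι : Type*} (s : Finset ι) {g : ι → C.Key → ℝ} (h : ∀ i f, 0 ≤ g i f) :
    C.keyAvg (fun f => ∑ i ∈ s, g i f) = ∑ i ∈ s, C.keyAvg (g i) := by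
  classical
  induction s using Finset.induction_on with
  | empty => simp [keyAvg]
  | insert a s ha ih =>
    simp_rw [Finset.sum_insert ha]
    rw [C.keyAvg_add (h a) (fun f => Finset.sum_nonneg fun i _ => h i f), ih]

/-- `H(A_{1:N}^[k] | W_I, F)` in nats. The average is finite, so that
`toReal` loses nothing, whenever `H(S)` is finite. -/
def answersNats (k : Fin K) (I : Finset (Fin K)) : ℝ :=
  (C.keyAvg (C.jointNats k I)).toReal - I.card * messageNats X L

variable {C}

namespace Admissible

variable {w ρ : ℝ}

lemma jointNats_le (h : C.Admissible w ρ) (hX : 1 < Fintype.card X) (hL : 0 < L) (hρ : 0 ≤ ρ)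
    (k : Fin K) (I : Finset (Fin K)) (f : C.Key) :
    C.jointNats k I f ≤ (K + ρ) * messageNats X L := by
  have hlog : 0 < Real.log (Fintype.card X) := Real.log_pos (by exact_mod_cast hX)
  refine (C.jointNats_mono k (Finset.subset_univ I) f).trans ?_
  have h1 := ofReal_finEntropy_dbLaw_le (M := Messages X K L) C.commonLaw (C.answersVec k f)
  have h2 : C.jointNats k Finset.univ f =
      finEntropy C.dataLaw (fun ω => (C.answersVec k f ω, ω.1)) :=
    finEntropy_congr _ _ _ fun ω ω' => by
      simp only [Prod.mk.injEq]
      exact ⟨fun h => ⟨h.1, funext fun i => congrFun h.2 i⟩,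
        fun h => ⟨h.1, funext fun i => congrFun h.2 ⟨i, Finset.mem_univ i⟩⟩⟩
  have h3 := h.commonRandomness_eq
  have h4 : C.law.map C.common = C.commonLaw := by
    have : C.law.map C.common = (C.law.map Prod.snd).map Prod.snd := by
      rw [PMF.map_comp]; rfl
    rw [this, law_map_snd, dbLaw_map_snd]
  rw [commonRandomness, entropy, h4] at h3
  set B := ∑' s, ENNReal.ofReal (Real.negMulLog (C.commonLaw s).toReal)
  have h5 : B = ENNReal.ofReal (ρ * messageNats X L) := by
    rw [messageNats, ENNReal.ofReal_mul hρ, ENNReal.ofReal_mul (Nat.cast_nonneg _),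
      ENNReal.ofReal_natCast, ← h3]
    have e1 : (L : ℝ≥0∞) ≠ 0 := by simpa using hL.ne'
    have e2 : ENNReal.ofReal (Real.log (Fintype.card X)) ≠ 0 := by simpa using hlog
    rw [← mul_assoc, ENNReal.div_mul_cancel e1 (by simp), ENNReal.div_mul_cancel e2 (by simp)]
  rw [h5, ← h2, log_card_messages, ENNReal.ofReal_le_ofReal_iff
    (mul_nonneg hρ messageNats_nonneg)] at h1
  linarith

lemma keyAvg_ne_top (h : C.Admissible w ρ) (hX : 1 < Fintype.card X) (hL : 0 < L) (hρ : 0 ≤ ρ)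
    (k : Fin K) (I : Finset (Fin K)) : C.keyAvg (C.jointNats k I) ≠ ⊤ := by
  refine ne_top_of_le_ne_top ?_ (C.keyAvg_mono fun f => h.jointNats_le hX hL hρ k I f)
  rw [keyAvg_const]
  exact ENNReal.ofReal_ne_top

/-- `H(A_{1:N}^[k] | W_{1:K}, F) ≤ H(S)`. -/
lemma answersNats_univ_le (h : C.Admissible w ρ) (hX : 1 < Fintype.card X) (hL : 0 < L)
    (hρ : 0 ≤ ρ) (k : Fin K) : C.answersNats k Finset.univ ≤ ρ * messageNats X L := by
  have h1 := C.keyAvg_mono fun f => h.jointNats_le hX hL hρ k Finset.univ f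
  rw [keyAvg_const] at h1
  have h0 := messageNats_nonneg (X := X) (L := L)
  have h2 := ENNReal.toReal_le_of_le_ofReal (by positivity) h1
  rw [answersNats, Finset.card_univ, Fintype.card_fin]
  linarith

/-- Conditioning on the retrieved message removes its entropy:
`H(A_{1:N}^[k] | W_I, F) = H(W_k) + H(A_{1:N}^[k] | W_k, W_I, F)`. -/
lemma answersNats_insert (h : C.Admissible w ρ) {k : Fin K}
    {I : Finset (Fin K)} (hk : k ∉ I) :
    C.answersNats k I = messageNats X L + C.answersNats k (insert k I) := by
  have h1 := h.recoverable k
  rw [condEntropy_answers_key, ENNReal.div_eq_zero_iff] at h1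
  have h2 := ENNReal.tsum_eq_zero.1 (h1.resolve_right ENNReal.ofReal_ne_top)
  have h3 : C.keyAvg (C.jointNats k (insert k I)) = C.keyAvg (C.jointNats k I) := by
    refine tsum_congr fun f => ?_
    rcases mul_eq_zero.1 (h2 f) with h4 | h4
    · rw [h4, zero_mul, zero_mul]
    · rw [C.jointNats_insert (sub_nonpos.1 (ENNReal.ofReal_eq_zero.1 h4))]
  rw [answersNats, answersNats, h3, Finset.card_insert_of_notMem hk]
  push_cast
  ring

/-- By privacy, `H(A_{1:N}^[k'] | W_I, F) ≤ ∑ₙ H(Aₙ | W_I, Qₙ) ≤ N H(A_{1:N}^[k] | W_I, F)`. -/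
lemma answersNats_le_mul (h : C.Admissible w ρ) (hX : 1 < Fintype.card X) (hL : 0 < L)
    (hρ : 0 ≤ ρ) (hN : 0 < N) (k k' : Fin K) (I : Finset (Fin K)) :
    C.answersNats k' I ≤ N * C.answersNats k I := by
  set c : ℝ := I.card * messageNats X L with hc
  have hc0 : 0 ≤ c := mul_nonneg (Nat.cast_nonneg _) messageNats_nonneg
  have hN1 : (1 : ℝ) ≤ N := by exact_mod_cast hN
  have h1 : C.keyAvg (C.jointNats k' I) + ENNReal.ofReal ((N - 1) * c) ≤
      ∑ n, C.keyAvg (fun f => C.answerNats I n (C.query k' f n)) := by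
    rw [← C.keyAvg_const, ← C.keyAvg_add (C.jointNats_nonneg k' I)
      (fun _ => mul_nonneg (by linarith) hc0), ← C.keyAvg_sum _ fun n f => C.answerNats_nonneg I n _]
    refine C.keyAvg_mono fun f => ?_
    have := C.jointNats_sub_le k' I f
    rw [Finset.sum_sub_distrib] at this
    simp only [Finset.sum_const, Finset.card_univ, Fintype.card_fin, nsmul_eq_mul] at this
    linarith
  have h2 : ∀ n, C.keyAvg (fun f => C.answerNats I n (C.query k' f n)) ≤
      C.keyAvg (C.jointNats k I) := by
    intro n
    have e : ∀ k, C.keyAvg (fun f => C.answerNats I n (C.query k f n)) =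
        ∑' q, C.keyLaw.map (fun f => C.query k f n) q * ENNReal.ofReal (C.answerNats I n q) :=
      fun k => (tsum_map_mul _ _ fun q => ENNReal.ofReal (C.answerNats I n q)).symm
    rw [e, h.isPrivate n k' k, ← e]
    exact C.keyAvg_mono fun f => C.answerNats_le k I f n
  have h3 := h1.trans (Finset.sum_le_sum fun n _ => h2 n)
  rw [Finset.sum_const, Finset.card_univ, Fintype.card_fin, nsmul_eq_mul] at h3
  have f1 := h.keyAvg_ne_top hX hL hρ k I
  have f2 := h.keyAvg_ne_top hX hL hρ k' I
  have h4 := ENNReal.toReal_mono (ENNReal.mul_ne_top (by simp) f1) h3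
  rw [ENNReal.toReal_add f2 ENNReal.ofReal_ne_top, ENNReal.toReal_mul, ENNReal.toReal_natCast,
    ENNReal.toReal_ofReal (mul_nonneg (by linarith) hc0)] at h4
  rw [answersNats, answersNats, ← hc]
  linarith

/-- The leakage constraint: `H(A_{1:N}^[k] | F) ≤ H(A_{1:N}^[k] | W_k', F) + w H(W_k')`. -/
lemma answersNats_empty_le (h : C.Admissible w ρ) (hX : 1 < Fintype.card X) (hL : 0 < L)
    (hρ : 0 ≤ ρ) (hw : 0 ≤ w) {k k' : Fin K} (hk : k' ≠ k) :
    C.answersNats k ∅ ≤ C.answersNats k {k'} + w * messageNats X L := by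
  have hlog : 0 < Real.log (Fintype.card X) := Real.log_pos (by exact_mod_cast hX)
  have e0 : ENNReal.ofReal (Real.log (Fintype.card X)) ≠ 0 := by simpa using hlog
  have hL0 : (L : ℝ≥0∞) ≠ 0 := by simpa using hL.ne'
  have h1 := h.leakage_le k k' hk
  rw [leakage, ENNReal.div_le_iff hL0 (by simp), mutualInfo, tsub_le_iff_right, entropy_eq,
    condEntropy_queries_answers_key] at h1
  have h0 : finEntropy C.law (C.message k') = messageNats X L := by
    rw [← C.finEntropy_message k', ← law_map_snd, finEntropy, finEntropy]
    unfold prob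
    rw [PMF.map_comp]
    rfl
  have h2 := mul_le_mul_left h1 (ENNReal.ofReal (Real.log (Fintype.card X)))
  rw [add_mul, ENNReal.div_mul_cancel e0 (by simp), ENNReal.div_mul_cancel e0 (by simp), h0] at h2
  have hmono : ∀ f, 0 ≤ finEntropy C.dataLaw (fun ω => (ω.1 k', C.answersVec k f ω)) -
          finEntropy C.dataLaw (C.answersVec k f) := fun f => by
    rw [← C.jointNats_empty, ← C.jointNats_singleton]
    exact sub_nonneg.2 (C.jointNats_mono k (Finset.empty_subset _) f)
  have h3 : C.keyAvg (C.jointNats k {k'}) = C.keyAvg (C.jointNats k ∅) +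
      ∑' f, C.keyLaw f * ENNReal.ofReal
        (finEntropy C.dataLaw (fun ω => (ω.1 k', C.answersVec k f ω)) -
          finEntropy C.dataLaw (C.answersVec k f)) := by
    rw [← keyAvg, ← C.keyAvg_add (C.jointNats_nonneg k ∅) hmono]
    congr 1
    funext f
    rw [C.jointNats_empty, C.jointNats_singleton]
    ring
  have h4 : ENNReal.ofReal w * L * ENNReal.ofReal (Real.log (Fintype.card X)) =
      ENNReal.ofReal (w * messageNats X L) := by
    rw [messageNats, ENNReal.ofReal_mul hw, ENNReal.ofReal_mul (Nat.cast_nonneg _),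
      ENNReal.ofReal_natCast, mul_assoc]
  rw [h4] at h2
  have f1 := h.keyAvg_ne_top hX hL hρ k ∅
  have f2 := h.keyAvg_ne_top hX hL hρ k {k'}
  have hΛ := messageNats_nonneg (X := X) (L := L)
  have h5 : C.keyAvg (C.jointNats k ∅) + ENNReal.ofReal (messageNats X L) ≤
      C.keyAvg (C.jointNats k {k'}) + ENNReal.ofReal (w * messageNats X L) := by
    rw [h3, add_assoc]
    gcongr
    rwa [add_comm] at h2
  have h6 := ENNReal.toReal_mono (by simp [f2]) h5
  rw [ENNReal.toReal_add f1 (by simp), ENNReal.toReal_add f2 (by simp), ENNReal.toReal_ofReal hΛ,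
    ENNReal.toReal_ofReal (mul_nonneg hw hΛ)] at h6
  rw [answersNats, answersNats, Finset.card_empty, Finset.card_singleton]
  push_cast
  linarith

lemma answersNats_nonneg (h : C.Admissible w ρ) (hX : 1 < Fintype.card X) (hL : 0 < L)
    (hρ : 0 ≤ ρ) (k : Fin K) (I : Finset (Fin K)) : 0 ≤ C.answersNats k I := by
  have h1 := C.keyAvg_mono fun f => C.le_jointNats k I f
  rw [keyAvg_const] at h1
  have h2 := (ENNReal.ofReal_le_iff_le_toReal (h.keyAvg_ne_top hX hL hρ k I)).1 h1
  rw [answersNats]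
  linarith

/-- `H(A_{1:N}^[k] | F) ≤ D`. -/
lemma answersNats_le_downloadCost (h : C.Admissible w ρ) (hX : 1 < Fintype.card X) (hL : 0 < L)
    (hρ : 0 ≤ ρ) (k : Fin K) :
    ENNReal.ofReal (C.answersNats k ∅ / Real.log (Fintype.card X)) ≤ C.downloadCost k := by
  have hlog : 0 < Real.log (Fintype.card X) := Real.log_pos (by exact_mod_cast hX)
  have h1 : C.keyAvg (C.jointNats k ∅) ≤
      ∑ n, C.keyAvg (fun f => Real.log (Fintype.card C.Y) * C.len n (C.query k f n)) := by
    rw [← C.keyAvg_sum _ fun n f => mul_nonneg (Real.log_natCast_nonneg _) (Nat.cast_nonneg _)]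
    refine C.keyAvg_mono fun f => ?_
    have := C.jointNats_sub_le k ∅ f
    simp only [Finset.card_empty, Nat.cast_zero, zero_mul, sub_zero] at this
    refine this.trans (Finset.sum_le_sum fun n _ => ?_)
    have e : C.answerNats ∅ n (C.query k f n) =
        finEntropy C.dataLaw (C.answerVec n (C.query k f n)) :=
      finEntropy_congr _ _ _ fun ω ω' => by
        simp [Subsingleton.elim (messagesIn (∅ : Finset (Fin K)) ω) (messagesIn ∅ ω')]
    rw [e]
    refine (finEntropy_le_log_card _ _).trans_eq ?_
    rw [card_vector, Nat.cast_pow, Real.log_pow, mul_comm]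
  have h2 : ENNReal.ofReal (Real.log (Fintype.card X)) * C.downloadCost k =
      ∑ n, C.keyAvg (fun f => Real.log (Fintype.card C.Y) * C.len n (C.query k f n)) := by
    have e : C.fintypeY = (inferInstance : Fintype C.Y) := rfl
    rw [downloadCost, e, ← mul_assoc, ← ENNReal.ofReal_mul hlog.le, Real.logb,
      mul_div_cancel₀ _ hlog.ne', Finset.mul_sum]
    refine Finset.sum_congr rfl fun n _ => ?_
    rw [tsum_map_mul _ _ fun q => (C.len n q : ℝ≥0∞), ← ENNReal.tsum_mul_left]
    refine tsum_congr fun f => ?_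
    rw [ENNReal.ofReal_mul (Real.log_natCast_nonneg _), ENNReal.ofReal_natCast]
    ring
  have e0 : ENNReal.ofReal (Real.log (Fintype.card X)) ≠ 0 := by simpa using hlog
  rw [← h2] at h1
  rw [answersNats, Finset.card_empty, Nat.cast_zero, zero_mul, sub_zero,
    ENNReal.ofReal_div_of_pos hlog, ENNReal.ofReal_toReal (h.keyAvg_ne_top hX hL hρ k ∅)]
  exact ENNReal.div_le_of_le_mul' h1

/-- The bound for private information retrieval without a leakage constraint, relative to the
messages in `I`. -/
lemma sum_le_answersNats (h : C.Admissible w ρ) (hX : 1 < Fintype.card X) (hL : 0 < L)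
    (hρ : 0 ≤ ρ) (hN : 0 < N) (r : ℕ) : ∀ (I : Finset (Fin K)) (k : Fin K), k ∉ I →
      I.card + r = K →
      messageNats X L * ∑ i ∈ Finset.range r, 1 / (N : ℝ) ^ i ≤ C.answersNats k I := by
  have hN0 : (0 : ℝ) < N := by exact_mod_cast hN
  induction r with
  | zero =>
    intro I k _ _
    simpa using h.answersNats_nonneg hX hL hρ k I
  | succ r ih =>
    intro I k hk hcard
    rw [h.answersNats_insert hk, Finset.sum_range_succ']
    have hstep : messageNats X L * ∑ i ∈ Finset.range r, 1 / (N : ℝ) ^ i ≤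
        N * C.answersNats k (insert k I) := by
      rcases Nat.eq_zero_or_pos r with rfl | hr
      · simpa using mul_nonneg hN0.le (h.answersNats_nonneg hX hL hρ k (insert k I))
      have hc : (insert k I).card = I.card + 1 := Finset.card_insert_of_notMem hk
      obtain ⟨k', hk'⟩ : ∃ k', k' ∉ insert k I := by
        by_contra! hall
        have : insert k I = Finset.univ := Finset.eq_univ_iff_forall.2 hall
        rw [this, Finset.card_univ, Fintype.card_fin] at hc
        omega
      exact (ih _ k' hk' (by omega)).trans (h.answersNats_le_mul hX hL hρ hN k k' _)
    have e : ∑ i ∈ Finset.range r, 1 / (N : ℝ) ^ (i + 1) =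
        (∑ i ∈ Finset.range r, 1 / (N : ℝ) ^ i) / N := by
      rw [Finset.sum_div]
      exact Finset.sum_congr rfl fun i _ => by rw [pow_succ, div_div]
    rw [e, mul_add, pow_zero, div_one, mul_one, ← mul_div_assoc]
    have := (div_le_iff₀' hN0).2 hstep
    linarith

/-- One step of the recursion between two desired messages:
`N H(A^[k] | F) + w H(W_k) ≥ N H(W_k) + H(A^[k'] | F)`. -/
lemma answersNats_exchange (h : C.Admissible w ρ) (hX : 1 < Fintype.card X) (hL : 0 < L)
    (hρ : 0 ≤ ρ) (hw : 0 ≤ w) (hN : 0 < N) {k k' : Fin K} (hk : k' ≠ k) :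
    N * messageNats X L + C.answersNats k' ∅ ≤
      N * C.answersNats k ∅ + w * messageNats X L := by
  have h1 := h.answersNats_insert (Finset.notMem_empty k)
  rw [insert_empty_eq] at h1
  have h2 := h.answersNats_le_mul hX hL hρ hN k k' {k}
  have h3 := h.answersNats_empty_le hX hL hρ hw hk.symm
  rw [h1]
  linarith

/-- The exchange inequality in both directions, solved for the larger of the two entropies. -/
lemma exists_le_answersNats (h : C.Admissible w ρ) (hX : 1 < Fintype.card X) (hL : 0 < L)
    (hρ : 0 ≤ ρ) (hw : 0 ≤ w) (hN : 2 ≤ N) {k k' : Fin K} (hk : k' ≠ k) :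
    ∃ j j', j' ≠ j ∧ (N - w) / (N - 1) * messageNats X L ≤ C.answersNats j ∅ := by
  have hN2 : (2 : ℝ) ≤ N := by exact_mod_cast hN
  have key : ∀ a b : ℝ, N * messageNats X L + b ≤ N * a + w * messageNats X L → b ≥ a →
      (N - w) / (N - 1) * messageNats X L ≤ b := by
    intro a b h1 h2
    rw [div_mul_eq_mul_div, div_le_iff₀ (by linarith)]
    nlinarith
  rcases le_total (C.answersNats k ∅) (C.answersNats k' ∅) with hle | hle
  · exact ⟨k', k, hk.symm, key _ _ (h.answersNats_exchange hX hL hρ hw (by omega) hk) hle⟩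
  · exact ⟨k, k', hk, key _ _ (h.answersNats_exchange hX hL hρ hw (by omega) hk.symm) hle⟩

/-- The lower bound on the download cost. -/
theorem tradeoff_le (h : C.Admissible w ρ) (hX : 1 < Fintype.card X) (hL : 0 < L)
    (hρ : 0 ≤ ρ) (hw : 0 ≤ w) (hN : 2 ≤ N) (hK : 2 ≤ K) (k : Fin K) :
    ENNReal.ofReal (tradeoff K N w) ≤ C.downloadCost k / L := by
  have hlog : 0 < Real.log (Fintype.card X) := Real.log_pos (by exact_mod_cast hX)
  have hL' : (0 : ℝ) < L := by exact_mod_cast hL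
  suffices hs : ∃ j, tradeoff K N w * messageNats X L ≤ C.answersNats j ∅ by
    obtain ⟨j, hj⟩ := hs
    rw [C.downloadCost_eq h.isPrivate k j,
      ENNReal.le_div_iff_mul_le (Or.inl (by simpa using hL.ne')) (Or.inl (by simp))]
    refine le_trans ?_ (h.answersNats_le_downloadCost hX hL hρ j)
    rw [← ENNReal.ofReal_natCast, ← ENNReal.ofReal_mul' hL'.le]
    refine ENNReal.ofReal_le_ofReal ?_
    rw [le_div_iff₀ hlog, mul_assoc]
    exact hj
  have hN2 : (2 : ℝ) ≤ N := by exact_mod_cast hN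
  by_cases hwN : w ≤ 1 / (N : ℝ) ^ (K - 1)
  · obtain ⟨j, -, -, hj⟩ := h.exists_le_answersNats hX hL hρ hw hN
      (k := ⟨0, by omega⟩) (k' := ⟨1, by omega⟩) (by simp)
    refine ⟨j, ?_⟩
    rw [tradeoff, if_pos hwN]
    convert hj using 2
    have : (N : ℝ) - 1 ≠ 0 := by linarith
    field_simp
  · refine ⟨⟨0, by omega⟩, ?_⟩
    rw [tradeoff, if_neg hwN, mul_comm]
    exact h.sum_le_answersNats hX hL hρ (by omega) K ∅ _ (Finset.notMem_empty _) (by simp)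

/-- The lower bound on the amount of common randomness. -/
theorem rhoMin_le (h : C.Admissible w ρ) (hX : 1 < Fintype.card X) (hL : 0 < L)
    (hρ : 0 ≤ ρ) (hw : 0 ≤ w) (hN : 2 ≤ N) : rhoMin K N w ≤ ρ := by
  by_cases hK : K = 2
  swap
  · rwa [rhoMin, if_neg hK]
  have hN2 : (2 : ℝ) ≤ N := by exact_mod_cast hN
  have hΛ : 0 < messageNats X L :=
    mul_pos (by exact_mod_cast hL) (Real.log_pos (by exact_mod_cast hX))
  obtain ⟨j, j', hj', hj⟩ := h.exists_le_answersNats hX hL hρ hw hN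
    (k := ⟨0, by omega⟩) (k' := ⟨1, by omega⟩) (by simp)
  have hun : insert j {j'} = (Finset.univ : Finset (Fin K)) := by
    refine Finset.eq_univ_of_card _ ?_
    rw [Finset.card_pair hj'.symm, Fintype.card_fin, hK]
  have h1 := h.answersNats_insert (k := j) (I := {j'}) (by simpa using hj'.symm)
  rw [hun] at h1
  have h2 := h.answersNats_univ_le hX hL hρ j
  have h3 := h.answersNats_empty_le hX hL hρ hw hj'
  have h4 : ((N - w) / (N - 1) - 1 - w) * messageNats X L ≤ ρ * messageNats X L := by linarith
  have h5 := le_of_mul_le_mul_right h4 hΛ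
  rw [rhoMin, if_pos hK]
  have : (N : ℝ) - 1 ≠ 0 := by linarith
  refine le_trans (le_of_eq ?_) h5
  field_simp
  ring

end Admissible
end Scheme

/-! ### A family of schemes -/

lemma dbLaw_apply {M σ : Type*} [Fintype M] [Nonempty M] (p : PMF σ) (x : M) (s : σ) :
    dbLaw M p (x, s) = (Fintype.card M : ℝ≥0∞)⁻¹ * p s := by
  have h := map_bind_fiber_apply (PMF.uniformOfFintype M) p id Prod.fst (fun _ _ => rfl) (x, s)
  have h2 := map_injective_apply p (e := fun s : σ => (x, s)) (Prod.mk_right_injective x) s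
  rw [PMF.map_id] at h
  simp only [id_def] at h
  rw [dbLaw, h, h2]
  simp

/-- Conditioning on more increases no conditional entropy: if `A` is a function of `V`, then
`H(U | V) ≤ H(U | A)`. -/
lemma finEntropy_cond_mono {Ω α β γ : Type*} [Fintype α] [Fintype β] [Fintype γ] (μ : PMF Ω)
    (U : Ω → α) (V : Ω → β) (A : Ω → γ) (h : ∀ ω ω', V ω = V ω' → A ω = A ω') :
    finEntropy μ (fun ω => (U ω, V ω)) - finEntropy μ V ≤
      finEntropy μ (fun ω => (U ω, A ω)) - finEntropy μ A := by
  have h1 := finEntropy_submodular μ U V A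
  have h2 := finEntropy_congr μ (fun ω => (V ω, A ω)) V fun ω ω' => by
    simp only [Prod.mk.injEq]
    exact ⟨fun e => ⟨e, h _ _ e⟩, fun e => e.1⟩
  have h3 := finEntropy_le_of_factors μ (fun ω => (U ω, V ω)) (fun ω => (U ω, V ω, A ω)) (by
    simp only [Prod.mk.injEq]
    exact fun ω ω' e => ⟨e.1, e.2.1⟩)
  linarith

/-- The group in which the partial sums of the messages live. -/
abbrev Block (m b : ℕ) : Type := Fin b → ZMod m

/-- The data that distinguish the schemes of the family.

Every message is split into blocks numbered by the nonzero elements of `ZMod N`. For a vector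
`v` of elements of `ZMod N`, one for every message, a database adds the blocks numbered by `v` and
a mask which is a function of `S`. The block with number `0` is computed from the block with
number `1` by the map `zeroBlock`. This map, the mask and the length of the answer to `v = 0` depend
on the mode of operation, a random bit that the user chooses and tells the databases. -/
structure Code (m b : ℕ) where
  /-- the values of the common randomness `S` -/
  Common : Type
  /-- there are finitely many values -/
  fintypeCommon : Fintype Common
  /-- distribution of `S` -/
  commonLaw : PMF Common
  /-- distribution of the mode of operation -/
  modeLaw : PMF Bool
  /-- the length of the answer to `v = 0` -/
  shortLen : Bool → ℕ
  /-- the block with number `0` as a function of the block with number `1` -/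
  zeroBlock : Bool → Block m b → Block m b
  /-- the mask as a function of `S` -/
  mask : Bool → Common → Block m b
  shortLen_le : ∀ c, shortLen c ≤ b
  zeroBlock_sub_injective : ∀ c, Function.Injective fun x => zeroBlock c x - x
  zeroBlock_apply : ∀ c x (j : Fin b), shortLen c ≤ j → zeroBlock c x j = 0
  mask_apply : ∀ c s (j : Fin b), shortLen c ≤ j → mask c s j = 0

namespace Code

open Scheme

instance {m b : ℕ} (D : Code m b) : Fintype D.Common := D.fintypeCommon

variable {X : Type*} [Fintype X] [Nonempty X] {K N b : ℕ} [NeZero N] [Fact (1 < N)]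

instance : NeZero (Fintype.card X) := ⟨Fintype.card_ne_zero⟩

omit [Fact (1 < N)] in
lemma card_nonzero : Fintype.card {j : ZMod N // j ≠ 0} = N - 1 := by
  rw [Fintype.card_subtype_compl, ZMod.card, Fintype.card_subtype_eq]

variable (X N b) in
/-- The blocks of a message. Any bijection will do, since the messages are uniform. -/
def blocks : (Fin (b * (N - 1)) → X) ≃ ({j : ZMod N // j ≠ 0} → Block (Fintype.card X) b) :=
  Fintype.equivOfCardEq (by simp [pow_mul])

variable (D : Code (Fintype.card X) b)

/-- The block with number `j` of the message `x`. -/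
def block (c : Bool) (j : ZMod N) (x : Fin (b * (N - 1)) → X) : Block (Fintype.card X) b :=
  if h : j = 0 then D.zeroBlock c (blocks X N b x ⟨1, one_ne_zero⟩) else blocks X N b x ⟨j, h⟩

/-- The sum that the answer to the query `(v, c)` encodes. -/
def value (q : (Fin K → ZMod N) × Bool) (ω : Messages X K (b * (N - 1)) × D.Common) :
    Block (Fintype.card X) b :=
  ∑ i, D.block q.2 (q.1 i) (ω.1 i) + D.mask q.2 ω.2

/-- The length of the answer to a query. -/
def queryLen (q : (Fin K → ZMod N) × Bool) : ℕ := if q.1 = 0 then D.shortLen q.2 else b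

omit [Nonempty X] [NeZero N] [Fact (1 < N)] in
lemma queryLen_le (q : (Fin K → ZMod N) × Bool) : D.queryLen q ≤ b := by
  unfold queryLen
  split_ifs
  · exact D.shortLen_le _
  · exact le_rfl

/-- The scheme: `F` is a uniform vector `v` together with the mode, and the query to database `n` is
`v + n eₖ` together with the mode. -/
def scheme (K N : ℕ) [NeZero N] [Fact (1 < N)] : Scheme X K N (b * (N - 1)) where
  Key := (Fin K → ZMod N) × Bool
  keyLaw := dbLaw (Fin K → ZMod N) D.modeLaw
  Common := D.Common
  commonLaw := D.commonLaw
  Query := fun _ => (Fin K → ZMod N) × Bool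
  query := fun k f n => (f.1 + Pi.single k ((n : ℕ) : ZMod N), f.2)
  Y := ZMod (Fintype.card X)
  fintypeY := inferInstance
  len := fun _ q => D.queryLen q
  answer := fun _ q W s => (List.ofFn (D.value q (W, s))).take (D.queryLen q)
  answer_length := fun _ q W s => by simp [D.queryLen_le q]

/-- The part of the sum that does not come from the desired message `k`. -/
def interference (k : Fin K) (f : (Fin K → ZMod N) × Bool)
    (ω : Messages X K (b * (N - 1)) × D.Common) : Block (Fintype.card X) b :=
  ∑ i ∈ Finset.univ.erase k, D.block f.2 (f.1 i) (ω.1 i) + D.mask f.2 ω.2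

lemma value_query (k : Fin K) (f : (Fin K → ZMod N) × Bool) (n : Fin N)
    (ω : Messages X K (b * (N - 1)) × D.Common) :
    D.value ((D.scheme K N).query k f n) ω =
      D.block f.2 (f.1 k + ((n : ℕ) : ZMod N)) (ω.1 k) + D.interference k f ω := by
  unfold value interference
  rw [← Finset.add_sum_erase _ _ (Finset.mem_univ k), add_assoc]
  congr 1
  · simp [scheme]
  · congr 1
    refine Finset.sum_congr rfl fun i hi => ?_
    simp [scheme, Finset.ne_of_mem_erase hi]

lemma value_apply_eq_zero (q : (Fin K → ZMod N) × Bool)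
    (ω : Messages X K (b * (N - 1)) × D.Common) (j : Fin b) (hj : D.queryLen q ≤ j) :
    D.value q ω j = 0 := by
  by_cases h : q.1 = 0
  · rw [queryLen, if_pos h] at hj
    simp [value, h, block, D.mask_apply _ _ _ hj, D.zeroBlock_apply _ _ _ hj]
  · rw [queryLen, if_neg h] at hj
    exact absurd j.2 (not_lt.2 hj)

/-- The answer determines the sum, since the omitted coordinates vanish. -/
lemma value_eq_of_answer_eq (q : (Fin K → ZMod N) × Bool)
    (ω ω' : Messages X K (b * (N - 1)) × D.Common)
    (h : (List.ofFn (D.value q ω)).take (D.queryLen q) =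
      (List.ofFn (D.value q ω')).take (D.queryLen q)) : D.value q ω = D.value q ω' := by
  funext j
  rcases lt_or_ge (j : ℕ) (D.queryLen q) with hj | hj
  · have h1 := congrArg (fun l => l[(j : ℕ)]?) h
    simpa [List.getElem?_take, hj] using h1
  · rw [D.value_apply_eq_zero q ω j hj, D.value_apply_eq_zero q ω' j hj]

lemma answersVec_eq_iff (k : Fin K) (f : (Fin K → ZMod N) × Bool)
    (ω ω' : Messages X K (b * (N - 1)) × D.Common) :
    (D.scheme K N).answersVec k f ω = (D.scheme K N).answersVec k f ω' ↔
      ∀ j, D.block f.2 j (ω.1 k) + D.interference k f ω =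
        D.block f.2 j (ω'.1 k) + D.interference k f ω' := by
  constructor
  · intro h j
    have hn := congrArg List.Vector.toList
      (congrFun h ⟨(j - f.1 k).val, ZMod.val_lt _⟩)
    have := D.value_eq_of_answer_eq _ ω ω' hn
    rw [value_query, value_query] at this
    simpa using this
  · intro h
    funext n
    refine List.Vector.toList_injective ?_
    have := h (f.1 k + ((n : ℕ) : ZMod N))
    rw [← value_query, ← value_query] at this
    exact congrArg (fun x => (List.ofFn x).take _) this

/-- The answers are a function of the desired message and of the interference. -/
lemma answersVec_eq_of_eq (k : Fin K) (f : (Fin K → ZMod N) × Bool)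
    (ω ω' : Messages X K (b * (N - 1)) × D.Common) (h : ω.1 k = ω'.1 k)
    (h' : D.interference k f ω = D.interference k f ω') :
    (D.scheme K N).answersVec k f ω = (D.scheme K N).answersVec k f ω' := by
  rw [answersVec_eq_iff]
  intro j
  rw [h, h']

/-- The answers determine the desired message: the interference is the same in all the answers, and
it is found from the blocks with numbers `0` and `1`. -/
lemma message_eq_of_answersVec_eq (k : Fin K) (f : (Fin K → ZMod N) × Bool)
    (ω ω' : Messages X K (b * (N - 1)) × D.Common)
    (h : (D.scheme K N).answersVec k f ω = (D.scheme K N).answersVec k f ω') :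
    ω.1 k = ω'.1 k := by
  rw [answersVec_eq_iff] at h
  have h0 := h 0
  have h1 := h 1
  rw [block, block, dif_pos rfl, dif_pos rfl] at h0
  rw [block, block, dif_neg one_ne_zero, dif_neg one_ne_zero] at h1
  have e : blocks X N b (ω.1 k) ⟨1, one_ne_zero⟩ = blocks X N b (ω'.1 k) ⟨1, one_ne_zero⟩ := by
    refine D.zeroBlock_sub_injective f.2 ?_
    have := congrArg₂ (· - ·) h0 h1
    simpa using this
  rw [e] at h1
  have e2 : D.interference k f ω = D.interference k f ω' := add_left_cancel h1
  refine (blocks X N b).injective (funext fun j => ?_)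
  have h2 := h j
  rw [block, block, dif_neg j.2, dif_neg j.2, e2] at h2
  exact add_right_cancel h2

lemma scheme_recoverable : (D.scheme K N).Recoverable := by
  intro k
  rw [Scheme.condEntropy_answers_key, ENNReal.div_eq_zero_iff]
  left
  refine ENNReal.tsum_eq_zero.2 fun f => ?_
  rw [ENNReal.ofReal_eq_zero.2, mul_zero]
  rw [sub_nonpos]
  refine finEntropy_le_of_factors _ _ _ fun ω ω' h => ?_
  rw [Prod.mk.injEq]
  exact ⟨D.message_eq_of_answersVec_eq k f ω ω' h, h⟩

/-- The query to any database has the law of `F`. -/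
lemma map_query (k : Fin K) (n : Fin N) :
    (D.scheme K N).keyLaw.map (fun f => (D.scheme K N).query k f n) =
      dbLaw (Fin K → ZMod N) D.modeLaw := by
  set e : (Fin K → ZMod N) × Bool → (Fin K → ZMod N) × Bool :=
    fun f => (f.1 + Pi.single k ((n : ℕ) : ZMod N), f.2)
  have he : e.Injective := by
    rintro ⟨v, c⟩ ⟨v', c'⟩ h
    simpa [e] using h
  ext ⟨v, c⟩
  have h := map_injective_apply (dbLaw (Fin K → ZMod N) D.modeLaw) he
    (v - Pi.single k ((n : ℕ) : ZMod N), c)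
  have h' : e (v - Pi.single k ((n : ℕ) : ZMod N), c) = (v, c) := by simp [e]
  rw [h', dbLaw_apply, ← dbLaw_apply D.modeLaw v c] at h
  exact h

lemma scheme_private : (D.scheme K N).Private := by
  intro n k k'
  rw [map_query, map_query]

/-- The probability of the mode `c`. -/
def modeProb (c : Bool) : ℝ := (D.modeLaw c).toReal

omit [Nonempty X] in
lemma modeProb_nonneg (c : Bool) : 0 ≤ D.modeProb c := ENNReal.toReal_nonneg

omit [Nonempty X] in
lemma sum_modeProb : ∑ c, D.modeProb c = 1 := by
  have := sum_prob D.modeLaw id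
  simpa [prob, PMF.map_id, modeProb] using this

omit [Nonempty X] [Fact (1 < N)] in
/-- The average over the vector `v` and over the mode. -/
lemma tsum_keyLaw_mul (g : (Fin K → ZMod N) × Bool → ℝ) (hg : ∀ q, 0 ≤ g q) :
    ∑' q, dbLaw (Fin K → ZMod N) D.modeLaw q * ENNReal.ofReal (g q) =
      ENNReal.ofReal (∑ c, D.modeProb c * ((∑ v, g (v, c)) / (N : ℝ) ^ K)) := by
  have e : ∀ q, dbLaw (Fin K → ZMod N) D.modeLaw q * ENNReal.ofReal (g q) =
      ENNReal.ofReal (D.modeProb q.2 * (g q / (N : ℝ) ^ K)) := by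
    rintro ⟨v, c⟩
    have hN : (0 : ℝ) < (N : ℝ) ^ K := pow_pos (by exact_mod_cast NeZero.pos N) K
    rw [dbLaw_apply, ENNReal.ofReal_mul (D.modeProb_nonneg c), ENNReal.ofReal_div_of_pos hN,
      modeProb, ENNReal.ofReal_toReal (PMF.apply_ne_top _ _), ENNReal.ofReal_pow (by positivity),
      ENNReal.ofReal_natCast, div_eq_mul_inv]
    simp only [Fintype.card_pi_const, ZMod.card, Nat.cast_pow]
    ring
  simp_rw [e]
  rw [tsum_fintype, ← ENNReal.ofReal_sum_of_nonneg fun q _ =>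
    mul_nonneg (D.modeProb_nonneg _) (div_nonneg (hg q) (by positivity)),
    Fintype.sum_prod_type_right]
  simp_rw [Finset.sum_div, Finset.mul_sum]

/-- Only the answers to the query `v = 0` are shorter than `b`. -/
lemma scheme_downloadCost (hX : 1 < Fintype.card X) (k : Fin K) :
    (D.scheme K N).downloadCost k = ENNReal.ofReal (N * (b -
      (∑ c, D.modeProb c * ((b : ℝ) - D.shortLen c)) / (N : ℝ) ^ K)) := by
  have hN : (0 : ℝ) < (N : ℝ) ^ K := pow_pos (by exact_mod_cast NeZero.pos N) K
  have hY : Real.logb (Fintype.card X)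
      (@Fintype.card (D.scheme K N).Y (D.scheme K N).fintypeY) = 1 := by
    change Real.logb _ (Fintype.card (ZMod (Fintype.card X)) : ℝ) = 1
    rw [ZMod.card]
    exact Real.logb_self_eq_one (by exact_mod_cast hX)
  rw [Scheme.downloadCost, hY, ENNReal.ofReal_one, one_mul]
  simp_rw [map_query]
  change ∑ n : Fin N, ∑' q, dbLaw (Fin K → ZMod N) D.modeLaw q * ((D.queryLen q : ℕ) : ℝ≥0∞) = _
  simp_rw [← ENNReal.ofReal_natCast]
  rw [tsum_keyLaw_mul D (fun q => (D.queryLen q : ℝ)) fun q => Nat.cast_nonneg _, Finset.sum_const,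
    Finset.card_univ, Fintype.card_fin, nsmul_eq_mul, ← ENNReal.ofReal_natCast,
    ← ENNReal.ofReal_mul (Nat.cast_nonneg _)]
  congr 2
  have e : ∀ c, ∑ v : Fin K → ZMod N, (D.queryLen (v, c) : ℝ) =
      (N : ℝ) ^ K * b - ((b : ℝ) - D.shortLen c) := by
    intro c
    have : ∀ v : Fin K → ZMod N, (D.queryLen (v, c) : ℝ) =
        b - if v = 0 then ((b : ℝ) - D.shortLen c) else 0 := by
      intro v
      unfold queryLen
      split_ifs <;> simp
    simp_rw [this]
    rw [Finset.sum_sub_distrib, Finset.sum_ite_eq' Finset.univ (0 : Fin K → ZMod N)]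
    simp [ZMod.card]
  simp_rw [e, sub_div, mul_div_cancel_left₀ (b : ℝ) hN.ne', mul_sub]
  rw [Finset.sum_sub_distrib, ← Finset.sum_mul, sum_modeProb, one_mul, Finset.sum_div]
  congr 1
  refine Finset.sum_congr rfl fun c _ => ?_
  ring

/-! ### Leakage of the schemes -/

/-- The answers for the key `f` leak nothing about `W_k'` if they do not depend on `W_k'`. -/
lemma leak_of_independent {k k' : Fin K} (hk : k' ≠ k) (f : (Fin K → ZMod N) × Bool)
    (hf : ∀ x x' : Fin (b * (N - 1)) → X, D.block f.2 (f.1 k') x = D.block f.2 (f.1 k') x') :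
    messageNats X (b * (N - 1)) ≤
      finEntropy (D.scheme K N).dataLaw (fun ω => (ω.1 k', (D.scheme K N).answersVec k f ω)) -
        finEntropy (D.scheme K N).dataLaw ((D.scheme K N).answersVec k f) := by
  set Λ := messageNats X (b * (N - 1))
  set μ : PMF (Messages X K (b * (N - 1)) × D.Common) := (D.scheme K N).dataLaw
  set V : Messages X K (b * (N - 1)) × D.Common → _ :=
    fun ω => (messagesIn (Finset.univ.erase k') ω, ω.2)
  refine le_trans ?_ (finEntropy_cond_mono μ (fun ω => ω.1 k') V _ ?_)
  · have h1 : finEntropy μ (fun ω => (ω.2, ω.1)) = K * Λ + finEntropy D.commonLaw id := by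
      rw [← log_card_messages]
      exact finEntropy_dbLaw_snd D.commonLaw id
    have h2 : finEntropy μ (fun ω => (ω.2, ω.1)) ≤ finEntropy μ (fun ω => (ω.1 k', V ω)) := by
      refine finEntropy_le_of_factors _ _ _ fun ω ω' h => ?_
      simp only [V, Prod.mk.injEq] at h ⊢
      refine ⟨h.2.2, funext fun i => ?_⟩
      by_cases hi : i = k'
      · rw [hi]; exact h.1
      · exact congrFun h.2.1 ⟨i, by simp [hi]⟩
    have h3 := finEntropy_prod_le μ (messagesIn (Finset.univ.erase k')) (fun ω => ω.2)
    have h4 := finEntropy_messagesIn_le μ (Finset.univ.erase k')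
    have h5 : finEntropy μ (fun ω => ω.2) = finEntropy D.commonLaw id := by
      have : μ.map Prod.snd = D.commonLaw := dbLaw_map_snd _
      rw [finEntropy, finEntropy]
      unfold prob
      rw [PMF.map_id, ← this]
    rw [Finset.card_erase_of_mem (Finset.mem_univ _), Finset.card_univ, Fintype.card_fin,
      Nat.cast_pred k.pos] at h4
    change _ ≤ finEntropy μ (fun ω => (ω.1 k', V ω)) - finEntropy μ
      (fun ω => (messagesIn (Finset.univ.erase k') ω, ω.2))
    linarith
  · intro ω ω' h
    simp only [V, Prod.mk.injEq] at h
    refine D.answersVec_eq_of_eq k f ω ω' (congrFun h.1 ⟨k, by simp [hk.symm]⟩) ?_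
    unfold interference
    rw [h.2]
    congr 1
    refine Finset.sum_congr rfl fun i hi => ?_
    by_cases hi' : i = k'
    · rw [hi']; exact hf _ _
    · congr 1
      exact congrFun h.1 ⟨i, by simp [hi']⟩

lemma finEntropy_message_interference_le {k : Fin K} (f : (Fin K → ZMod N) × Bool)
    (μ : PMF (Messages X K (b * (N - 1)) × D.Common)) :
    finEntropy μ (fun ω => (ω.1 k, D.interference k f ω)) ≤
      messageNats X (b * (N - 1)) + b * Real.log (Fintype.card X) := by
  refine (finEntropy_le_log_card _ _).trans_eq ?_
  rw [Fintype.card_prod, Nat.cast_mul, Real.log_mul (by simp) (by simp)]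
  simp [messageNats, Real.log_pow, ZMod.card]

/-- The answers leak at most as much about `W_k'` as is missing from the mask to a uniform one. -/
lemma leak_le_of_mask {k k' : Fin K} (hk : k' ≠ k) (f : (Fin K → ZMod N) × Bool) :
    messageNats X (b * (N - 1)) -
        (b * Real.log (Fintype.card X) - finEntropy D.commonLaw (D.mask f.2)) ≤
      finEntropy (D.scheme K N).dataLaw (fun ω => (ω.1 k', (D.scheme K N).answersVec k f ω)) -
        finEntropy (D.scheme K N).dataLaw ((D.scheme K N).answersVec k f) := by
  set Λ := messageNats X (b * (N - 1)) with hΛ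
  set μ : PMF (Messages X K (b * (N - 1)) × D.Common) := (D.scheme K N).dataLaw
  set V : Messages X K (b * (N - 1)) × D.Common → _ := fun ω => (ω.1 k, D.interference k f ω)
  refine le_trans ?_ (finEntropy_cond_mono μ (fun ω => ω.1 k') V _ ?_)
  · obtain ⟨B, hB⟩ : ∃ B, B = (Finset.univ.erase k').erase k := ⟨_, rfl⟩
    have h1 : finEntropy μ (fun ω => (D.mask f.2 ω.2, ω.1)) =
        K * Λ + finEntropy D.commonLaw (D.mask f.2) := by
      rw [← log_card_messages]
      exact finEntropy_dbLaw_snd D.commonLaw (D.mask f.2)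
    have h2 : finEntropy μ (fun ω => (D.mask f.2 ω.2, ω.1)) ≤
        finEntropy μ (fun ω => ((ω.1 k', V ω), messagesIn B ω)) := by
      refine finEntropy_le_of_factors _ _ _ fun ω ω' h => ?_
      simp only [V, Prod.mk.injEq] at h ⊢
      have hW : ω.1 = ω'.1 := by
        funext i
        by_cases hi : i = k'
        · rw [hi]; exact h.1.1
        by_cases hi' : i = k
        · rw [hi']; exact h.1.2.1
        · exact congrFun h.2 ⟨i, by simp [hB, hi, hi']⟩
      refine ⟨?_, hW⟩
      have := h.1.2.2
      unfold interference at this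
      rw [hW] at this
      exact add_left_cancel this
    have h3 := finEntropy_prod_le μ (fun ω => (ω.1 k', V ω)) (messagesIn B)
    have h4 := finEntropy_messagesIn_le μ B
    have h5 := D.finEntropy_message_interference_le (k := k) f μ
    have h6 : (B.card : ℝ) = K - 2 := by
      have h7 := Finset.card_erase_add_one (Finset.mem_univ k')
      have h8 := Finset.card_erase_add_one (Finset.mem_erase.2 ⟨hk.symm, Finset.mem_univ k⟩)
      rw [Finset.card_univ, Fintype.card_fin] at h7
      rw [← hB] at h8
      rw [eq_sub_iff_add_eq]
      exact_mod_cast (by omega : B.card + 2 = K)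
    rw [h6] at h4
    change _ ≤ finEntropy μ (fun ω => (ω.1 k', V ω)) - finEntropy μ
      (fun ω => (ω.1 k, D.interference k f ω))
    linarith
  · intro ω ω' h
    exact D.answersVec_eq_of_eq k f ω ω' (Prod.mk.inj h).1 (Prod.mk.inj h).2

/-- A third message hides `W_k'` if its block in the interference is uniform, which is the case if
the number of the block is not `0` or if block number `0` is a bijective image of block number `1`. -/
lemma leak_of_third {k k' i : Fin K} (hk : k' ≠ k) (hi : i ≠ k) (hi' : i ≠ k')
    (f : (Fin K → ZMod N) × Bool) (hf : f.1 i ≠ 0 ∨ Function.Injective (D.zeroBlock f.2)) :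
    messageNats X (b * (N - 1)) ≤
      finEntropy (D.scheme K N).dataLaw (fun ω => (ω.1 k', (D.scheme K N).answersVec k f ω)) -
        finEntropy (D.scheme K N).dataLaw ((D.scheme K N).answersVec k f) := by
  set Λ := messageNats X (b * (N - 1)) with hΛ
  set μ : PMF (Messages X K (b * (N - 1)) × D.Common) := (D.scheme K N).dataLaw
  obtain ⟨j, hj⟩ : ∃ j : {j : ZMod N // j ≠ 0}, ∀ x x' : Fin (b * (N - 1)) → X,
      D.block f.2 (f.1 i) x = D.block f.2 (f.1 i) x' → blocks X N b x j = blocks X N b x' j := by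
    by_cases h0 : f.1 i = 0
    · refine ⟨⟨1, one_ne_zero⟩, fun x x' h => ?_⟩
      rw [block, block, dif_pos h0, dif_pos h0] at h
      exact hf.resolve_left (not_not.2 h0) h
    · refine ⟨⟨f.1 i, h0⟩, fun x x' h => ?_⟩
      rwa [block, block, dif_neg h0, dif_neg h0] at h
  set V : Messages X K (b * (N - 1)) × D.Common → _ := fun ω => (ω.1 k, D.interference k f ω)
  set R : Messages X K (b * (N - 1)) × D.Common → ({j' // j' ≠ j} → Block (Fintype.card X) b) :=
    fun ω j' => blocks X N b (ω.1 i) j'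
  refine le_trans ?_ (finEntropy_cond_mono μ (fun ω => ω.1 k') V _ ?_)
  · obtain ⟨B, hB⟩ : ∃ B, B = ((Finset.univ.erase k').erase k).erase i := ⟨_, rfl⟩
    have h1 : finEntropy μ (fun ω => (ω.2, ω.1)) = K * Λ + finEntropy D.commonLaw id := by
      rw [← log_card_messages]
      exact finEntropy_dbLaw_snd D.commonLaw id
    have h2 : finEntropy μ (fun ω => (ω.2, ω.1)) ≤
        finEntropy μ (fun ω => ((ω.1 k', V ω), (messagesIn B ω, R ω), ω.2)) := by
      refine finEntropy_le_of_factors _ _ _ fun ω ω' h => ?_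
      simp only [V, R, Prod.mk.injEq] at h ⊢
      obtain ⟨⟨e1, e2, e3⟩, ⟨e4, e5⟩, e6⟩ := h
      refine ⟨e6, ?_⟩
      have hW : ∀ i', i' ≠ i → ω.1 i' = ω'.1 i' := by
        intro i' hii
        by_cases hi : i' = k'
        · rw [hi]; exact e1
        by_cases hi' : i' = k
        · rw [hi']; exact e2
        · exact congrFun e4 ⟨i', by simp [hB, hi, hi', hii]⟩
      have e7 : D.block f.2 (f.1 i) (ω.1 i) = D.block f.2 (f.1 i) (ω'.1 i) := by
        unfold interference at e3
        rw [e6] at e3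
        have e8 := add_right_cancel e3
        have hmem : i ∈ Finset.univ.erase k := by simp [hi]
        rw [← Finset.add_sum_erase _ _ hmem, ← Finset.add_sum_erase _ _ hmem,
          Finset.sum_congr rfl fun i' h' => by rw [hW i' (Finset.ne_of_mem_erase h')]] at e8
        exact add_right_cancel e8
      funext i'
      by_cases hii : i' = i
      · rw [hii]
        refine (blocks X N b).injective (funext fun j' => ?_)
        by_cases hjj : j' = j
        · rw [hjj]; exact hj _ _ e7
        · exact congrFun e5 ⟨j', hjj⟩
      · exact hW i' hii
    have h3 := finEntropy_prod_le μ (fun ω => (ω.1 k', V ω))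
      (fun ω => ((messagesIn B ω, R ω), ω.2))
    have h3' := finEntropy_prod_le μ (fun ω => (messagesIn B ω, R ω)) (fun ω => ω.2)
    have h3'' := finEntropy_prod_le μ (messagesIn B) R
    have h4 := finEntropy_messagesIn_le μ B
    have h5 := D.finEntropy_message_interference_le (k := k) f μ
    have h6 : (B.card : ℝ) = K - 3 := by
      have h7 := Finset.card_erase_add_one (Finset.mem_univ k')
      have h8 := Finset.card_erase_add_one (Finset.mem_erase.2 ⟨hk.symm, Finset.mem_univ k⟩)
      have h9 := Finset.card_erase_add_one
        (Finset.mem_erase.2 ⟨hi, Finset.mem_erase.2 ⟨hi', Finset.mem_univ i⟩⟩)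
      rw [Finset.card_univ, Fintype.card_fin] at h7
      rw [← hB] at h9
      rw [eq_sub_iff_add_eq]
      exact_mod_cast (by omega : B.card + 3 = K)
    have h7 : finEntropy μ (fun ω => ω.2) = finEntropy D.commonLaw id := by
      have : μ.map Prod.snd = D.commonLaw := dbLaw_map_snd _
      rw [finEntropy, finEntropy]
      unfold prob
      rw [PMF.map_id, ← this]
    have h8 : finEntropy μ R ≤ Λ - b * Real.log (Fintype.card X) := by
      refine (finEntropy_le_log_card _ _).trans_eq ?_
      have hN : 1 < N := Fact.out
      have hc : Fintype.card {j' // j' ≠ j} = N - 2 := by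
        rw [Fintype.card_subtype_compl, card_nonzero, Fintype.card_subtype_eq]
        omega
      have hc2 : Fintype.card ({j' // j' ≠ j} → Block (Fintype.card X) b) =
          Fintype.card X ^ (b * (N - 2)) := by
        rw [Fintype.card_fun, hc, Fintype.card_fun, ZMod.card, Fintype.card_fin, pow_mul]
      rw [hc2, Nat.cast_pow, Real.log_pow, hΛ, messageNats, Nat.cast_mul, Nat.cast_mul,
        Nat.cast_sub (by omega), Nat.cast_sub (by omega)]
      push_cast
      ring
    rw [h6] at h4
    change _ ≤ finEntropy μ (fun ω => (ω.1 k', V ω)) - finEntropy μ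
      (fun ω => (ω.1 k, D.interference k f ω))
    linarith
  · intro ω ω' h
    exact D.answersVec_eq_of_eq k f ω ω' (Prod.mk.inj h).1 (Prod.mk.inj h).2

/-- With `k` desired, the interference for the vector `v` contains a block with nonzero number of the
message `k'`, and of no other message. -/
def Exposes (k k' : Fin K) (v : Fin K → ZMod N) : Prop :=
  v k' ≠ 0 ∧ ∀ i, i ≠ k → i ≠ k' → v i = 0

omit [Fact (1 < N)] in
open Classical in
lemma card_exposes_le (k k' : Fin K) :
    Fintype.card {v : Fin K → ZMod N // Exposes k k' v} ≤ N * (N - 1) := by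
  have h : Fintype.card (ZMod N × {j : ZMod N // j ≠ 0}) = N * (N - 1) := by
    rw [Fintype.card_prod, card_nonzero, ZMod.card]
  rw [← h]
  refine Fintype.card_le_of_injective (fun v => (v.1 k, ⟨v.1 k', v.2.1⟩)) fun v v' hv => ?_
  simp only [Prod.mk.injEq, Subtype.mk.injEq] at hv
  refine Subtype.ext (funext fun i => ?_)
  by_cases h1 : i = k
  · rw [h1]; exact hv.1
  by_cases h2 : i = k'
  · rw [h2]; exact hv.2
  rw [v.2.2 i h1 h2, v'.2.2 i h1 h2]

lemma exists_third (hK : 3 ≤ K) (k k' : Fin K) : ∃ i, i ≠ k ∧ i ≠ k' := by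
  by_contra! h
  have h1 : (Finset.univ : Finset (Fin K)) ⊆ {k, k'} := fun i _ => by
    by_cases hi : i = k
    · simp [hi]
    · simp [h i hi]
  have h2 := (Finset.card_le_card h1).trans Finset.card_le_two
  rw [Finset.card_univ, Fintype.card_fin] at h2
  omega

open Classical in
/-- In the mode `c`, at most `t c` symbols leak, and only for the exposing vectors. -/
lemma leak_le {t : Bool → ℝ} (ht : ∀ c, 0 ≤ t c)
    (hmode : ∀ c, ((∀ x, D.zeroBlock c x = 0) ∧
        (b - t c) * Real.log (Fintype.card X) ≤ finEntropy D.commonLaw (D.mask c)) ∨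
      (3 ≤ K ∧ Function.Injective (D.zeroBlock c)))
    {k k' : Fin K} (hk : k' ≠ k) (f : (Fin K → ZMod N) × Bool) :
    messageNats X (b * (N - 1)) -
        (if Exposes k k' f.1 then t f.2 * Real.log (Fintype.card X) else 0) ≤
      finEntropy (D.scheme K N).dataLaw (fun ω => (ω.1 k', (D.scheme K N).answersVec k f ω)) -
        finEntropy (D.scheme K N).dataLaw ((D.scheme K N).answersVec k f) := by
  have hlog : 0 ≤ Real.log (Fintype.card X) := Real.log_natCast_nonneg _
  have hpos : 0 ≤ if Exposes k k' f.1 then t f.2 * Real.log (Fintype.card X) else 0 := by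
    split_ifs
    · exact mul_nonneg (ht _) hlog
    · exact le_rfl
  by_cases h3 : ∃ i, i ≠ k ∧ i ≠ k' ∧ f.1 i ≠ 0
  · obtain ⟨i, hi, hi', h⟩ := h3
    exact (sub_le_self _ hpos).trans (D.leak_of_third hk hi hi' f (Or.inl h))
  push Not at h3
  rcases hmode f.2 with ⟨hz, hm⟩ | ⟨hK, hinj⟩
  · by_cases h0 : f.1 k' = 0
    · refine (sub_le_self _ hpos).trans (D.leak_of_independent hk f fun x x' => ?_)
      rw [block, block, dif_pos h0, dif_pos h0, hz, hz]
    · rw [if_pos ⟨h0, h3⟩]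
      refine le_trans ?_ (D.leak_le_of_mask hk f)
      linarith
  · obtain ⟨i, hi, hi'⟩ := exists_third hK k k'
    exact (sub_le_self _ hpos).trans (D.leak_of_third hk hi hi' f (Or.inr hinj))

/-- In every mode `c`, either block number `0` vanishes and the mask lacks at most `t c` symbols of
entropy, or there are three messages and block number `0` is uniform. -/
theorem scheme_admissible (hX : 1 < Fintype.card X) (hb : 0 < b) {w ρ : ℝ} (hw : 0 ≤ w)
    (hρ : 0 ≤ ρ) {t : Bool → ℝ} (ht : ∀ c, 0 ≤ t c)
    (hmode : ∀ c, ((∀ x, D.zeroBlock c x = 0) ∧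
        (b - t c) * Real.log (Fintype.card X) ≤ finEntropy D.commonLaw (D.mask c)) ∨
      (3 ≤ K ∧ Function.Injective (D.zeroBlock c)))
    (hleak : ∑ c, D.modeProb c * t c ≤ w * b * (N : ℝ) ^ (K - 1))
    (hcommon : finEntropy D.commonLaw id = ρ * messageNats X (b * (N - 1))) :
    (D.scheme K N).Admissible w ρ := by
  classical
  have hlog : 0 < Real.log (Fintype.card X) := Real.log_pos (by exact_mod_cast hX)
  have e0 : ENNReal.ofReal (Real.log (Fintype.card X)) ≠ 0 := by simpa using hlog
  have hN1 : 1 < N := Fact.out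
  have hL : 0 < b * (N - 1) := Nat.mul_pos hb (by omega)
  have hL0 : ((b * (N - 1) : ℕ) : ℝ≥0∞) ≠ 0 := Nat.cast_ne_zero.2 hL.ne'
  have hLt : ((b * (N - 1) : ℕ) : ℝ≥0∞) ≠ ⊤ := ENNReal.natCast_ne_top _
  set Λ := messageNats X (b * (N - 1)) with hΛ
  have hΛ0 : 0 ≤ Λ := messageNats_nonneg
  refine ⟨D.scheme_recoverable, D.scheme_private, fun k k' hk => ?_, ?_⟩
  · rw [leakage, ENNReal.div_le_iff hL0 hLt, mutualInfo, tsub_le_iff_right, entropy_eq,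
      condEntropy_queries_answers_key, ENNReal.div_le_iff e0 (by simp), add_mul,
      ENNReal.div_mul_cancel e0 (by simp)]
    have h1 : finEntropy (D.scheme K N).law ((D.scheme K N).message k') ≤ Λ := by
      refine (finEntropy_le_log_card _ _).trans_eq ?_
      simp [hΛ, messageNats, Real.log_pow]
    have h2 : ENNReal.ofReal w * ((b * (N - 1) : ℕ) : ℝ≥0∞) *
        ENNReal.ofReal (Real.log (Fintype.card X)) = ENNReal.ofReal (w * Λ) := by
      rw [hΛ, messageNats, ENNReal.ofReal_mul hw, ENNReal.ofReal_mul (Nat.cast_nonneg _),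
        ENNReal.ofReal_natCast, mul_assoc]
    set δ : (Fin K → ZMod N) × Bool → ℝ := fun f =>
      if Exposes k k' f.1 then t f.2 * Real.log (Fintype.card X) else 0
    have h3 : ENNReal.ofReal (∑ c, D.modeProb c * ((∑ v, max 0 (Λ - δ (v, c))) / (N : ℝ) ^ K)) ≤
        ∑' f, (D.scheme K N).keyLaw f * ENNReal.ofReal
        (finEntropy (D.scheme K N).dataLaw (fun ω => (ω.1 k', (D.scheme K N).answersVec k f ω)) -
          finEntropy (D.scheme K N).dataLaw ((D.scheme K N).answersVec k f)) := by
      rw [← tsum_keyLaw_mul D (fun q => max 0 (Λ - δ q)) fun q => le_max_left _ _]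
      refine ENNReal.tsum_le_tsum fun f => mul_le_mul_right ?_ _
      rw [ENNReal.ofReal_max, ENNReal.ofReal_zero]
      exact max_le (by simp) (ENNReal.ofReal_le_ofReal (D.leak_le ht hmode hk f))
    rw [h2]
    refine le_trans ?_ (add_le_add le_rfl h3)
    have hN0 : (0 : ℝ) < N := by exact_mod_cast NeZero.pos N
    have hNK : (0 : ℝ) < (N : ℝ) ^ K := pow_pos hN0 K
    have h4 : ∀ c, Λ - t c * Real.log (Fintype.card X) * (N * (N - 1)) / (N : ℝ) ^ K ≤
        (∑ v, max 0 (Λ - δ (v, c))) / (N : ℝ) ^ K := by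
      intro c
      have h5 : ∑ v, (Λ - δ (v, c)) ≤ ∑ v, max 0 (Λ - δ (v, c)) :=
        Finset.sum_le_sum fun v _ => le_max_right _ _
      have h6 : ∑ v, δ (v, c) ≤ t c * Real.log (Fintype.card X) * (N * (N - 1)) := by
        simp only [δ]
        rw [← Finset.sum_filter, Finset.sum_const, nsmul_eq_mul, mul_comm, ← Fintype.card_subtype]
        refine mul_le_mul_of_nonneg_left ?_ (mul_nonneg (ht c) hlog.le)
        have := card_exposes_le (N := N) k k'
        rw [← Nat.cast_pred (NeZero.pos N)]
        exact_mod_cast this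
      rw [Finset.sum_sub_distrib, Finset.sum_const, Finset.card_univ, nsmul_eq_mul] at h5
      simp only [Fintype.card_pi_const, ZMod.card, Nat.cast_pow] at h5
      rw [le_div_iff₀ hNK, sub_mul, div_mul_cancel₀ _ hNK.ne']
      linarith
    have h7 : Λ - w * Λ ≤
        ∑ c, D.modeProb c * ((∑ v, max 0 (Λ - δ (v, c))) / (N : ℝ) ^ K) := by
      refine le_trans ?_ (Finset.sum_le_sum fun c _ =>
        mul_le_mul_of_nonneg_left (h4 c) (D.modeProb_nonneg c))
      simp_rw [mul_sub (D.modeProb _) Λ]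
      rw [Finset.sum_sub_distrib, ← Finset.sum_mul, sum_modeProb, one_mul]
      have h8 : ∑ c, D.modeProb c *
          (t c * Real.log (Fintype.card X) * (N * (N - 1)) / (N : ℝ) ^ K) =
          (∑ c, D.modeProb c * t c) * (Real.log (Fintype.card X) * (N * (N - 1)) / (N : ℝ) ^ K) := by
        rw [Finset.sum_mul]
        exact Finset.sum_congr rfl fun c _ => by ring
      have h9 : (N : ℝ) ^ K = (N : ℝ) ^ (K - 1) * N := by
        rw [← pow_succ, Nat.sub_add_cancel k.pos]
      have h10 : w * Λ = w * b * (N : ℝ) ^ (K - 1) *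
          (Real.log (Fintype.card X) * (N * (N - 1)) / (N : ℝ) ^ K) := by
        rw [hΛ, messageNats, h9, Nat.cast_mul, Nat.cast_pred (NeZero.pos N)]
        field_simp
      rw [h8, h10]
      have : (0 : ℝ) ≤ N - 1 := by
        have : (1 : ℝ) < N := by exact_mod_cast hN1
        linarith
      have := mul_le_mul_of_nonneg_right hleak
        (show 0 ≤ Real.log (Fintype.card X) * (N * (N - 1)) / (N : ℝ) ^ K by positivity)
      linarith
    refine (ENNReal.ofReal_le_ofReal h1).trans ?_
    refine (ENNReal.ofReal_le_ofReal (show Λ ≤ w * Λ + _ by linarith)).trans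
      ENNReal.ofReal_add_le
  · have h1 : (D.scheme K N).law.map (D.scheme K N).common = D.commonLaw := by
      have : (D.scheme K N).law.map (D.scheme K N).common =
          ((D.scheme K N).law.map Prod.snd).map Prod.snd := by
        rw [PMF.map_comp]; rfl
      rw [this, law_map_snd, dbLaw_map_snd]
      rfl
    have h2 : entropy (Fintype.card X) (D.scheme K N).law (D.scheme K N).common =
        entropy (Fintype.card X) D.commonLaw id := by
      rw [entropy, entropy, h1, PMF.map_id]
      rfl
    rw [commonRandomness, h2, entropy_eq, hcommon, hΛ, messageNats, ENNReal.ofReal_mul hρ,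
      ENNReal.ofReal_mul (Nat.cast_nonneg _), ENNReal.ofReal_natCast, ← mul_assoc,
      ENNReal.mul_div_cancel_right e0 (by simp), ENNReal.mul_div_cancel_right hL0 hLt]

end Code

/-! ### Laws with a given entropy -/

lemma finEntropy_id {α : Type*} [Fintype α] (p : PMF α) :
    finEntropy p id = ∑ a, Real.negMulLog (p a).toReal := by
  simp only [finEntropy, prob, PMF.map_id]

lemma exists_law_finEntropy_eq {α : Type*} [Fintype α] [Nonempty α] {t : ℝ} (h0 : 0 ≤ t)
    (h1 : t ≤ Real.log (Fintype.card α)) : ∃ p : PMF α, finEntropy p id = t := by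
  classical
  set a₀ : α := Classical.arbitrary α
  have hn : (0 : ℝ) < Fintype.card α := by exact_mod_cast Fintype.card_pos
  -- the segment from a point mass to the uniform law
  set q : ℝ → α → ℝ := fun τ a => (1 - τ) * (if a = a₀ then 1 else 0) + τ / Fintype.card α with hq
  set F : ℝ → ℝ := fun τ => ∑ a, Real.negMulLog (q τ a) with hF
  have hc : Continuous F := by
    refine continuous_finsetSum _ fun a _ => Real.continuous_negMulLog.comp ?_
    simp only [hq]
    fun_prop
  have hF0 : F 0 = 0 := by
    refine Finset.sum_eq_zero fun a _ => ?_
    by_cases h : a = a₀ <;> simp [hq, h]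
  have hF1 : F 1 = Real.log (Fintype.card α) := by
    simp [hF, hq, Real.negMulLog, hn.ne']
  obtain ⟨τ, ⟨hτ0, hτ1⟩, hτ⟩ := intermediate_value_Icc zero_le_one hc.continuousOn
    (show t ∈ Set.Icc (F 0) (F 1) by rw [hF0, hF1]; exact ⟨h0, h1⟩)
  have hq0 : ∀ a, 0 ≤ q τ a := fun a => by
    have : 0 ≤ 1 - τ := by linarith
    simp only [hq]
    split_ifs <;> positivity
  have hsum : ∑ a, ENNReal.ofReal (q τ a) = 1 := by
    rw [← ENNReal.ofReal_sum_of_nonneg fun a _ => hq0 a, ← ENNReal.ofReal_one]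
    congr 1
    simp only [hq]
    rw [Finset.sum_add_distrib, ← Finset.mul_sum, Finset.sum_ite_eq']
    simp only [Finset.mem_univ, if_true, Finset.sum_const, Finset.card_univ, nsmul_eq_mul]
    field_simp
    ring
  refine ⟨PMF.ofFintype _ hsum, ?_⟩
  rw [finEntropy_id, ← hτ]
  simp only [PMF.ofFintype_apply, ENNReal.toReal_ofReal (hq0 _)]
  rfl

lemma exists_fin_law_finEntropy_eq {t : ℝ} (h0 : 0 ≤ t) :
    ∃ (r : ℕ) (p : PMF (Fin r)), finEntropy p id = t := by
  refine ⟨⌈Real.exp t⌉₊, ?_⟩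
  have hr : 0 < ⌈Real.exp t⌉₊ := Nat.ceil_pos.2 (Real.exp_pos t)
  have : Nonempty (Fin ⌈Real.exp t⌉₊) := ⟨⟨0, hr⟩⟩
  refine exists_law_finEntropy_eq h0 ?_
  rw [Fintype.card_fin, Real.le_log_iff_exp_le (by exact_mod_cast hr)]
  exact Nat.le_ceil _

lemma exists_bool_law {θ : ℝ} (h0 : 0 ≤ θ) (h1 : θ ≤ 1) :
    ∃ p : PMF Bool, (p true).toReal = θ ∧ (p false).toReal = 1 - θ := by
  refine ⟨PMF.ofFintype (fun c => ENNReal.ofReal (cond c θ (1 - θ))) ?_, ?_, ?_⟩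
  · rw [Fintype.sum_bool, ← ENNReal.ofReal_add (by simpa) (by simpa)]
    simp
  · simpa using ENNReal.toReal_ofReal h0
  · simpa using ENNReal.toReal_ofReal (sub_nonneg.2 h1)

lemma finEntropy_dbLaw_id {M σ : Type*} [Fintype M] [Nonempty M] [Fintype σ] (p : PMF σ) :
    finEntropy (dbLaw M p) id = Real.log (Fintype.card M) + finEntropy p id := by
  have := finEntropy_dbLaw_snd (M := M) p id
  rw [← this]
  exact finEntropy_congr _ _ _ fun ω ω' => by simp [Prod.ext_iff, and_comm]

/-! ### Schemes on the tradeoff curve -/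

section Achievability

variable (X : Type*) [Fintype X] [Nonempty X]

lemma mem_achievableCosts {K N b : ℕ} [NeZero N] [Fact (1 < N)] (D : Code (Fintype.card X) b)
    (hX : 1 < Fintype.card X) (hb : 0 < b) {w ρ d : ℝ} (hw : 0 ≤ w)
    (hρ : 0 ≤ ρ) {t : Bool → ℝ} (ht : ∀ c, 0 ≤ t c)
    (hmode : ∀ c, ((∀ x, D.zeroBlock c x = 0) ∧
        (b - t c) * Real.log (Fintype.card X) ≤ finEntropy D.commonLaw (D.mask c)) ∨
      (3 ≤ K ∧ Function.Injective (D.zeroBlock c)))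
    (hleak : ∑ c, D.modeProb c * t c ≤ w * b * (N : ℝ) ^ (K - 1))
    (hcommon : finEntropy D.commonLaw id = ρ * Scheme.messageNats X (b * (N - 1)))
    (hd : d * (b * (N - 1)) =
      N * (b - (∑ c, D.modeProb c * ((b : ℝ) - D.shortLen c)) / (N : ℝ) ^ K)) :
    ENNReal.ofReal d ∈ achievableCosts X K N w ρ := by
  have hN : 1 < N := Fact.out
  have hL : 0 < b * (N - 1) := Nat.mul_pos hb (by omega)
  refine ⟨b * (N - 1), hL, D.scheme K N,
    D.scheme_admissible hX hb hw hρ ht hmode hleak hcommon, fun k => ?_⟩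
  have hL' : (0 : ℝ) < (b * (N - 1) : ℕ) := by exact_mod_cast hL
  rw [D.scheme_downloadCost hX, ← hd, ← ENNReal.ofReal_natCast, ← ENNReal.ofReal_div_of_pos hL',
    Nat.cast_mul, Nat.cast_pred (by omega)]
  rw [Nat.cast_mul, Nat.cast_pred (by omega)] at hL'
  rw [mul_div_cancel_right₀ _ hL'.ne']

/-- The schemes without masks: in the mode `false` the block with number `0` vanishes, and in the
mode `true` it is uniform. -/
def unmaskedCode (m : ℕ) {σ : Type} [hσ : Fintype σ] (p : PMF σ) (modeLaw : PMF Bool) :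
    Code m 2 where
  Common := σ
  fintypeCommon := hσ
  commonLaw := p
  modeLaw := modeLaw
  shortLen c := cond c 2 0
  zeroBlock c x := cond c ![x 1, x 0 + x 1] 0
  mask _ _ := 0
  shortLen_le c := by cases c <;> simp
  zeroBlock_sub_injective c x y h := by
    cases c
    · simpa using h
    · have h0 := congrFun h 0
      have h1 := congrFun h 1
      simp at h0 h1
      rw [h1] at h0
      funext j
      fin_cases j
      · exact h1
      · simpa using h0
  zeroBlock_apply c x j hj := by
    cases c
    · rfl
    · exact absurd j.2 (not_lt.2 hj)
  mask_apply _ _ _ _ := rfl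

/-- Two symbols per block suffice, with the matrix `!![0, 1; 1, 1]` for the mode `true`. -/
theorem tradeoff_mem_achievableCosts_of_three_le {K N : ℕ} (hX : 1 < Fintype.card X) (hN : 2 ≤ N)
    (hK : 3 ≤ K) {w ρ : ℝ} (hw : 0 ≤ w) (hw1 : w ≤ 1 / (N : ℝ) ^ (K - 1)) (hρ : 0 ≤ ρ) :
    ENNReal.ofReal (tradeoff K N w) ∈ achievableCosts X K N w ρ := by
  have : NeZero N := ⟨by omega⟩
  have : Fact (1 < N) := ⟨by omega⟩
  have hN2 : (2 : ℝ) ≤ N := by exact_mod_cast hN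
  have hNK : (0 : ℝ) < (N : ℝ) ^ (K - 1) := by positivity
  have hθ : w * (N : ℝ) ^ (K - 1) ≤ 1 := by rwa [le_div_iff₀ hNK] at hw1
  obtain ⟨q, hq1, hq0⟩ := exists_bool_law (θ := 1 - w * (N : ℝ) ^ (K - 1)) (by linarith)
    (by nlinarith)
  obtain ⟨r, p, hp⟩ := exists_fin_law_finEntropy_eq
    (mul_nonneg hρ (Scheme.messageNats_nonneg (X := X) (L := 2 * (N - 1))))
  refine mem_achievableCosts X (unmaskedCode (Fintype.card X) p q) hX two_pos hw hρ
    (t := fun c => cond c 0 2) (fun c => by cases c <;> simp) ?_ ?_ hp ?_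
  · intro c
    cases c
    · refine Or.inl ⟨fun x => rfl, ?_⟩
      simpa using finEntropy_nonneg _ _
    · refine Or.inr ⟨hK, fun x y h => ?_⟩
      have h0 := congrFun h 0
      have h1 := congrFun h 1
      simp [unmaskedCode] at h0 h1
      rw [h0] at h1
      funext j
      fin_cases j
      · simpa using h1
      · exact h0
  · simp only [Fintype.sum_bool, Code.modeProb, unmaskedCode, hq1, hq0]
    simp
    linarith
  · simp only [Fintype.sum_bool, Code.modeProb, unmaskedCode, hq1, hq0]
    rw [tradeoff, if_pos hw1]
    have h1 : (N : ℝ) - 1 ≠ 0 := by linarith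
    have h2 : (N : ℝ) ^ K = (N : ℝ) ^ (K - 1) * N := by
      rw [← pow_succ, Nat.sub_add_cancel (by omega)]
    rw [h2]
    simp
    field_simp

/-- The schemes in which the mask is a prefix, whose length depends on the mode, of a word which is
a function of `S`. -/
def maskedCode {m b a : ℕ} (hab : a ≤ b) {σ : Type} [hσ : Fintype σ] (p : PMF σ)
    (word : σ → Fin a → ZMod m) (modeLaw : PMF Bool) (len : Bool → ℕ) (hlen : ∀ c, len c ≤ a) :
    Code m b where
  Common := σ
  fintypeCommon := hσ
  commonLaw := p
  modeLaw := modeLaw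
  shortLen := len
  zeroBlock _ _ := 0
  mask c s j := if h : (j : ℕ) < len c then word s ⟨j, h.trans_le (hlen c)⟩ else 0
  shortLen_le c := (hlen c).trans hab
  zeroBlock_sub_injective c x y h := by simpa using h
  zeroBlock_apply _ _ _ _ := rfl
  mask_apply c s j hj := dif_neg (not_lt.2 hj)

lemma le_finEntropy_mask {m b a : ℕ} [NeZero m] (hab : a ≤ b) {σ : Type} [Fintype σ] (p : PMF σ)
    (word : σ → Fin a → ZMod m) (modeLaw : PMF Bool) (len : Bool → ℕ) (hlen : ∀ c, len c ≤ a)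
    (c : Bool) :
    finEntropy p word - (a - len c) * Real.log m ≤
      finEntropy p ((maskedCode hab p word modeLaw len hlen).mask c) := by
  set rest : σ → Fin (a - len c) → ZMod m := fun s j => word s ⟨len c + j, by omega⟩
  have h1 : finEntropy p word ≤ finEntropy p
      (fun s => ((maskedCode hab p word modeLaw len hlen).mask c s, rest s)) := by
    refine finEntropy_le_of_factors _ _ _ fun s s' h => ?_
    rw [Prod.mk.injEq] at h
    funext j
    rcases lt_or_ge (j : ℕ) (len c) with hj | hj
    · have := congrFun h.1 ⟨j, by omega⟩
      simpa [maskedCode, hj] using this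
    · have := congrFun h.2 ⟨j - len c, by omega⟩
      simpa [rest, hj] using this
  have h2 := finEntropy_prod_le p ((maskedCode hab p word modeLaw len hlen).mask c) rest
  have h3 : finEntropy p rest ≤ (a - len c) * Real.log m := by
    refine (finEntropy_le_log_card _ _).trans_eq ?_
    rw [Fintype.card_fun, ZMod.card, Fintype.card_fin, Nat.cast_pow, Real.log_pow,
      Nat.cast_sub (hlen c)]
  linarith

/-- For `K = 2`, a fraction `1 - N w` of every block is masked by uniform common randomness. The
two modes are needed if this fraction of `b` is not an integer. -/
theorem tradeoff_mem_achievableCosts_two {N b : ℕ} (hX : 1 < Fintype.card X) (hN : 2 ≤ N)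
    (hb : 0 < b) {w ρ : ℝ} (hw : 0 ≤ w) (hw1 : w ≤ 1 / N) (hρ : 0 ≤ ρ)
    (hbρ : (⌈(b : ℝ) * (1 - N * w)⌉₊ : ℝ) ≤ ρ * (b * (N - 1))) :
    ENNReal.ofReal (tradeoff 2 N w) ∈ achievableCosts X 2 N w ρ := by
  have : NeZero N := ⟨by omega⟩
  have : Fact (1 < N) := ⟨by omega⟩
  have hN2 : (2 : ℝ) ≤ N := by exact_mod_cast hN
  have hlog : 0 < Real.log (Fintype.card X) := Real.log_pos (by exact_mod_cast hX)
  have hb0 : (0 : ℝ) < b := by exact_mod_cast hb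
  have hNw : N * w ≤ 1 := by rwa [le_div_iff₀ (by linarith), mul_comm] at hw1
  have hNw0 : 0 ≤ N * w := by positivity
  set τ : ℝ := b * (1 - N * w) with hτ
  have hτ0 : 0 ≤ τ := mul_nonneg hb0.le (by linarith)
  have hτb : τ ≤ b := by nlinarith
  have hab : ⌈τ⌉₊ ≤ b := Nat.ceil_le.2 hτb
  have hfl := Nat.floor_le hτ0
  obtain ⟨q, hq1, hq0⟩ := exists_bool_law (θ := τ - ⌊τ⌋₊) (by linarith)
    (by have := Nat.lt_floor_add_one τ; linarith)
  have hmix : (τ - ⌊τ⌋₊) * ⌈τ⌉₊ + (1 - (τ - ⌊τ⌋₊)) * ⌊τ⌋₊ = τ := by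
    rcases eq_or_lt_of_le (Nat.floor_le_ceil τ) with h | h
    · have h1 := Nat.le_ceil τ
      rw [← h] at h1
      have h2 : τ = ⌊τ⌋₊ := le_antisymm h1 hfl
      rw [← h2]
      ring
    · have h1 : ⌈τ⌉₊ = ⌊τ⌋₊ + 1 := le_antisymm (Nat.ceil_le_floor_add_one τ) h
      rw [h1]
      push_cast
      ring
  have hNpred : ((N - 1 : ℕ) : ℝ) = N - 1 := by rw [Nat.cast_pred (by omega)]
  have hΛ : Scheme.messageNats X (b * (N - 1)) = b * (N - 1) * Real.log (Fintype.card X) := by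
    rw [Scheme.messageNats, Nat.cast_mul, hNpred]
  obtain ⟨r, p, hp⟩ := exists_fin_law_finEntropy_eq
    (t := ρ * Scheme.messageNats X (b * (N - 1)) - ⌈τ⌉₊ * Real.log (Fintype.card X)) (by
      rw [hΛ, sub_nonneg, ← mul_assoc]
      exact mul_le_mul_of_nonneg_right hbρ hlog.le)
  set M := Fin ⌈τ⌉₊ → ZMod (Fintype.card X)
  have hM : Real.log (Fintype.card M) = ⌈τ⌉₊ * Real.log (Fintype.card X) := by
    simp [M, ZMod.card, Real.log_pow]
  refine mem_achievableCosts X (maskedCode hab (dbLaw M p) Prod.fst q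
    (fun c => cond c ⌈τ⌉₊ ⌊τ⌋₊) (by
      intro c
      cases c
      · exact Nat.floor_le_ceil τ
      · exact le_rfl)) hX hb hw hρ
    (t := fun c => b - (cond c ⌈τ⌉₊ ⌊τ⌋₊ : ℕ)) ?_ ?_ ?_ ?_ ?_
  · have := (Nat.floor_le_ceil τ).trans hab
    intro c
    cases c <;> simpa
  · refine fun c => Or.inl ⟨fun x => rfl, ?_⟩
    refine le_trans (le_of_eq ?_) (le_finEntropy_mask hab (dbLaw M p) Prod.fst q _ _ c)
    rw [finEntropy_dbLaw_fst, hM]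
    ring
  · simp only [Fintype.sum_bool, Code.modeProb, maskedCode, hq1, hq0, cond_true, cond_false]
    norm_num
    nlinarith
  · change finEntropy (dbLaw M p) id = _
    rw [finEntropy_dbLaw_id, hM, hp]
    ring
  · simp only [Fintype.sum_bool, Code.modeProb, maskedCode, hq1, hq0, cond_true, cond_false]
    have e : (τ - ⌊τ⌋₊) * ((b : ℝ) - ⌈τ⌉₊) + (1 - (τ - ⌊τ⌋₊)) * (b - ⌊τ⌋₊) = b * N * w := by
      have : b * N * w = b - τ := by rw [hτ]; ring
      rw [this]
      linarith
    rw [e, tradeoff, if_pos (by simpa using hw1)]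
    have h1 : (N : ℝ) - 1 ≠ 0 := by linarith
    field_simp

/-- For `K = 2` and the least amount of common randomness, a mask with a law that need not be
uniform has exactly the entropy needed, and its length costs less than one symbol per block more
than its entropy. -/
theorem exists_achievableCosts_two_le {N b : ℕ} (hX : 1 < Fintype.card X) (hN : 2 ≤ N)
    (hb : 0 < b) {w : ℝ} (hw : 0 ≤ w) (hw1 : w ≤ 1 / N) :
    ∃ d ∈ achievableCosts X 2 N w (rhoMin 2 N w),
      d ≤ ENNReal.ofReal (tradeoff 2 N w + 1 / b) := by
  have : NeZero N := ⟨by omega⟩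
  have : Fact (1 < N) := ⟨by omega⟩
  have hN2 : (2 : ℝ) ≤ N := by exact_mod_cast hN
  have hN1 : (0 : ℝ) < N - 1 := by linarith
  have hlog : 0 < Real.log (Fintype.card X) := Real.log_pos (by exact_mod_cast hX)
  have hb0 : (0 : ℝ) < b := by exact_mod_cast hb
  have hNw : N * w ≤ 1 := by rwa [le_div_iff₀ (by linarith), mul_comm] at hw1
  have hNw0 : 0 ≤ N * w := by positivity
  set τ : ℝ := b * (1 - N * w) with hτ
  have hτ0 : 0 ≤ τ := mul_nonneg hb0.le (by linarith)
  have hτb : τ ≤ b := by nlinarith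
  have hab : ⌈τ⌉₊ ≤ b := Nat.ceil_le.2 hτb
  have hceil := Nat.ceil_lt_add_one hτ0
  have hrho : rhoMin 2 N w = (1 - N * w) / (N - 1) := by
    rw [rhoMin, if_pos rfl]
    field_simp
  have hNpred : ((N - 1 : ℕ) : ℝ) = N - 1 := by rw [Nat.cast_pred (by omega)]
  set M := Fin ⌈τ⌉₊ → ZMod (Fintype.card X)
  have hM : Real.log (Fintype.card M) = ⌈τ⌉₊ * Real.log (Fintype.card X) := by
    simp [M, ZMod.card, Real.log_pow]
  obtain ⟨p, hp⟩ := exists_law_finEntropy_eq (α := M) (t := τ * Real.log (Fintype.card X))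
    (by positivity) (by rw [hM]; exact mul_le_mul_of_nonneg_right (Nat.le_ceil τ) hlog.le)
  refine ⟨_, mem_achievableCosts X (maskedCode hab p id (PMF.pure true) (fun _ => ⌈τ⌉₊)
    (fun _ => le_rfl)) hX hb hw (by rw [hrho]; exact div_nonneg (by linarith) hN1.le)
    (d := N * (b - (b - ⌈τ⌉₊) / (N : ℝ) ^ 2) / (b * (N - 1)))
    (t := fun _ => b - τ) (fun _ => by linarith) ?_ ?_ ?_ ?_, ENNReal.ofReal_le_ofReal ?_⟩
  · refine fun c => Or.inl ⟨fun x => rfl, ?_⟩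
    refine le_trans (le_of_eq ?_) (le_finEntropy_mask hab p id (PMF.pure true) _ _ c)
    rw [hp]
    ring
  · rw [← Finset.sum_mul, Code.sum_modeProb, hτ]
    norm_num
    linarith
  · change finEntropy p id = _
    rw [hp, hrho, Scheme.messageNats, Nat.cast_mul, hNpred, hτ]
    field_simp
  · change _ = N * (b - (∑ c, Code.modeProb _ c * ((b : ℝ) - ⌈τ⌉₊)) / (N : ℝ) ^ 2)
    rw [← Finset.sum_mul, Code.sum_modeProb, one_mul, div_mul_cancel₀]
    positivity
  · rw [tradeoff, if_pos (by simpa using hw1), div_le_iff₀ (by positivity)]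
    have h1 : N * (b - (b - ⌈τ⌉₊) / (N : ℝ) ^ 2) ≤ N * (b - (b - (τ + 1)) / (N : ℝ) ^ 2) := by
      gcongr
    refine h1.trans ?_
    have h2 : N * (b - (b - (τ + 1)) / (N : ℝ) ^ 2) = N * b - w * b + 1 / N := by
      rw [hτ]
      field_simp
      ring
    have h3 : (N / (N - 1) - 1 / (N - 1) * w + 1 / b) * (b * (N - 1)) =
        N * b - w * b + (N - 1 : ℝ) := by
      field_simp
    have h4 : 1 / (N : ℝ) ≤ 1 := (div_le_one (by linarith)).2 (by linarith)
    rw [h2, h3]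
    linarith

end Achievability

/-! ### The tradeoff -/

section Tradeoff

variable {X : Type*} [Fintype X] [Nonempty X] {K N : ℕ} {w w' ρ : ℝ}

lemma achievableCosts_mono (h : w ≤ w') :
    achievableCosts X K N w ρ ⊆ achievableCosts X K N w' ρ := by
  rintro d ⟨L, hL, C, hC, hd⟩
  exact ⟨L, hL, C, ⟨hC.recoverable, hC.isPrivate, fun k k' hk =>
    (hC.leakage_le k k' hk).trans (ENNReal.ofReal_le_ofReal h), hC.commonRandomness_eq⟩, hd⟩

lemma tradeoff_eq_of_le (hN : 2 ≤ N) (hK : 2 ≤ K) (h : 1 / (N : ℝ) ^ (K - 1) ≤ w) :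
    tradeoff K N w = tradeoff K N (1 / (N : ℝ) ^ (K - 1)) := by
  rcases h.eq_or_lt with rfl | h
  · rfl
  have hN2 : (2 : ℝ) ≤ N := by exact_mod_cast hN
  rw [tradeoff, if_neg (not_le.2 h), tradeoff, if_pos le_rfl]
  have h1 : ∀ i, 1 / (N : ℝ) ^ i = ((N : ℝ)⁻¹) ^ i := fun i => by rw [one_div, inv_pow]
  have h2 : (N : ℝ) - 1 ≠ 0 := by linarith
  have h3 : (N : ℝ)⁻¹ ≠ 1 := inv_ne_one.2 (by linarith)
  have h4 : (N : ℝ) ^ K = (N : ℝ) ^ (K - 1) * N := by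
    rw [← pow_succ, Nat.sub_add_cancel (by omega)]
  simp_rw [h1]
  rw [geom_sum_eq h3, ← h1, ← h1, h4]
  have h5 : (N : ℝ)⁻¹ - 1 ≠ 0 := sub_ne_zero.2 h3
  have h6 : (1 : ℝ) - N ≠ 0 := by linarith
  field_simp
  ring

lemma tradeoff_le_minCost (hX : 1 < Fintype.card X) (hK : 2 ≤ K) (hN : 2 ≤ N) (hw : 0 ≤ w)
    (hρ : 0 ≤ ρ) : ENNReal.ofReal (tradeoff K N w) ≤ minCost X K N w ρ := by
  refine le_sInf ?_
  rintro d ⟨L, hL, C, hC, hd⟩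
  rw [hd ⟨0, by omega⟩]
  exact hC.tradeoff_le hX hL hρ hw hN hK _

lemma minCost_le_and_mem (hX : 1 < Fintype.card X) (hK : 2 ≤ K) (hN : 2 ≤ N) (hw : 0 ≤ w)
    (hw1 : w ≤ 1 / (N : ℝ) ^ (K - 1)) (hρ : 0 ≤ ρ) (h : rhoMin K N w ≤ ρ) :
    minCost X K N w ρ ≤ ENNReal.ofReal (tradeoff K N w) ∧
      ((3 ≤ K ∨ rhoMin K N w < ρ ∨ ∃ r : ℚ, w = r) →
        ENNReal.ofReal (tradeoff K N w) ∈ achievableCosts X K N w ρ) := by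
  by_cases hK3 : 3 ≤ K
  · have := tradeoff_mem_achievableCosts_of_three_le X hX hN hK3 hw hw1 hρ
    exact ⟨sInf_le this, fun _ => this⟩
  obtain rfl : K = 2 := by omega
  have hN2 : (2 : ℝ) ≤ N := by exact_mod_cast hN
  have hN1 : (0 : ℝ) < N - 1 := by linarith
  have hw2 : w ≤ 1 / N := by simpa using hw1
  have hNw : N * w ≤ 1 := by rwa [le_div_iff₀ (by linarith), mul_comm] at hw2
  have hrho : rhoMin 2 N w = (1 - N * w) / (N - 1) := by
    rw [rhoMin, if_pos rfl]
    field_simp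
  have hmem : (rhoMin 2 N w < ρ ∨ ∃ r : ℚ, w = r) →
      ENNReal.ofReal (tradeoff 2 N w) ∈ achievableCosts X 2 N w ρ := by
    rintro (hlt | ⟨r, rfl⟩)
    · rw [hrho, div_lt_iff₀ hN1] at hlt
      obtain ⟨b, hb⟩ := exists_nat_ge (1 / (ρ * (N - 1) - (1 - N * w)))
      have hgap : 0 < ρ * (N - 1) - (1 - N * w) := by linarith
      have hb0 : (0 : ℝ) < b := (by positivity : 0 < 1 / (ρ * (N - 1) - (1 - N * w))).trans_le hb
      refine tradeoff_mem_achievableCosts_two X hX hN (b := b) (by exact_mod_cast hb0) hw hw2 hρ ?_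
      have h1 := Nat.ceil_lt_add_one (mul_nonneg hb0.le (sub_nonneg.2 hNw))
      rw [div_le_iff₀ hgap] at hb
      linarith
    · rw [hrho, div_le_iff₀ hN1] at h
      set s : ℚ := 1 - N * r with hs
      have hsr : (s : ℝ) = 1 - N * r := by rw [hs]; push_cast; ring
      have hs0 : 0 ≤ s := by
        have : (0 : ℝ) ≤ s := by rw [hsr]; linarith
        exact_mod_cast this
      have hint : (s.den : ℝ) * (1 - N * r) = (s.num.toNat : ℕ) := by
        rw [← hsr]
        have h1 : (s.den : ℚ) * s = s.num := Rat.den_mul_eq_num s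
        have h2 : ((s.num.toNat : ℕ) : ℤ) = s.num := Int.toNat_of_nonneg (Rat.num_nonneg.2 hs0)
        have h3 : (s.den : ℚ) * s = ((s.num.toNat : ℕ) : ℚ) := by
          rw [h1]; exact_mod_cast h2.symm
        exact_mod_cast h3
      refine tradeoff_mem_achievableCosts_two X hX hN (b := s.den) s.den_pos hw hw2 hρ ?_
      have hd : (0 : ℝ) < s.den := by exact_mod_cast s.den_pos
      rw [hint, Nat.ceil_natCast, ← hint]
      nlinarith
  refine ⟨?_, fun h' => hmem (h'.resolve_left hK3)⟩
  rcases h.eq_or_lt with rfl | hlt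
  · have hlim : Filter.Tendsto (fun n : ℕ => ENNReal.ofReal (tradeoff 2 N w + 1 / ((n : ℝ) + 1)))
        Filter.atTop (nhds (ENNReal.ofReal (tradeoff 2 N w))) := by
      refine ENNReal.tendsto_ofReal ?_
      simpa using tendsto_const_nhds.add (tendsto_one_div_add_atTop_nhds_zero_nat (𝕜 := ℝ))
    refine ge_of_tendsto' hlim fun n => ?_
    obtain ⟨d, hd, hle⟩ := exists_achievableCosts_two_le X hX hN n.succ_pos hw hw2
    rw [Nat.cast_succ] at hle
    exact (sInf_le hd).trans hle
  · exact sInf_le (hmem (Or.inl hlt))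

end Tradeoff

end PIR

end

theorem theorem2 (X : Type*) [Fintype X] [Nontrivial X] (K N : ℕ) (hK : 2 ≤ K) (hN : 2 ≤ N)
    (w ρ : ℝ) (hw : 0 ≤ w) (hρ : 0 ≤ ρ) :
    (PIR.rhoMin K N w ≤ ρ →
      PIR.minCost X K N w ρ = ENNReal.ofReal (PIR.tradeoff K N w) ∧
      ((3 ≤ K ∨ PIR.rhoMin K N w < ρ ∨ ∃ r : ℚ, w = r) →
        ENNReal.ofReal (PIR.tradeoff K N w) ∈ PIR.achievableCosts X K N w ρ)) ∧
    (ρ < PIR.rhoMin K N w →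
      PIR.minCost X K N w ρ = ⊤ ∧
      ∀ L : ℕ, 0 < L → ∀ C : PIR.Scheme X K N L, ¬ C.Admissible w ρ) := by
  have hX : 1 < Fintype.card X := Fintype.one_lt_card
  have hN0 : (0 : ℝ) < N := by exact_mod_cast (by omega : 0 < N)
  refine ⟨fun h => ?_, fun h => ?_⟩
  · refine And.imp_left (fun hle => le_antisymm hle (PIR.tradeoff_le_minCost hX hK hN hw hρ)) ?_
    rcases le_or_gt w (1 / (N : ℝ) ^ (K - 1)) with hw1 | hw1
    · exact PIR.minCost_le_and_mem hX hK hN hw hw1 hρ h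
    · -- beyond the corner of the curve, the scheme for the corner is optimal
      have hr : PIR.rhoMin K N (1 / (N : ℝ) ^ (K - 1)) ≤ ρ := by
        unfold PIR.rhoMin
        split_ifs with hK2
        · subst hK2
          refine le_trans (le_of_eq ?_) hρ
          have : (N : ℝ) - 1 ≠ 0 := by
            have : (2 : ℝ) ≤ N := by exact_mod_cast hN
            linarith
          norm_num
          field_simp
          ring
        · exact hρ
      have hmem := PIR.achievableCosts_mono (X := X) hw1.le
        ((PIR.minCost_le_and_mem hX hK hN (by positivity) le_rfl hρ hr).2
          (Or.inr (Or.inr ⟨1 / (N : ℚ) ^ (K - 1), by push_cast; rfl⟩)))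
      rw [← PIR.tradeoff_eq_of_le hN hK hw1.le] at hmem
      exact ⟨sInf_le hmem, fun _ => hmem⟩
  · have hno : ∀ L : ℕ, 0 < L → ∀ C : PIR.Scheme X K N L, ¬ C.Admissible w ρ :=
      fun L hL C hC => absurd (hC.rhoMin_le hX hL hρ hw hN) (not_le.2 h)
    refine ⟨?_, hno⟩
    rw [PIR.minCost, sInf_eq_top]
    rintro d ⟨L, hL, C, hC, -⟩
    exact absurd hC (hno L hL C)
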